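/- **Setting.** Let $\mathbf X\in\mathbb R^{N\times P}$ be a data matrix (rows are samples), let each sample belong to one of $C\ge 1$ classes (the labels may have been permuted by any permutation $\sigma$ of the samples), and let $\mathbf Y\in\{0,1\}^{N\times C}$ be the class indicator matrix of the (permuted) labels. Let $\widetilde{\mathbf X}=[\mathbf X,\mathbf 1_N]$, let $\lambda\ge 0$ be a ridge parameter, and let $\mathbf I_0$ be the $(P+1)\times(P+1)$ identity matrix with its last diagonal entry replaced by $0$. Let $\mathbf H=\widetilde{\mathbf X}(\widetilde{\mathbf X}^\top\widetilde{\mathbf X}+\lambda\mathbf I_0)^{-1}\widetilde{\mathbf X}^\top$, $\hat{\mathbf E}=\mathbf Y-\mathbf H\mathbf Y$. Let $\mathrm{Te}\subseteq\{1,\dots,N\}$ be a test set and $\mathrm{Tr}$ its complement, of size $N_{\mathrm{Tr}}$; subscripts select rows, $\mathbf H_{\mathrm{Te}}$ is the $\mathrm{Te}\times\mathrm{Te}$ block of $\mathbf H$ and $\mathbf H_{\mathrm{Tr},\mathrm{Te}}$ its $\mathrm{Tr}\times\mathrm{Te}$ block. Assume that $\widetilde{\mathbf X}_{\mathrm{Tr}}^\top\widetilde{\mathbf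 X}_{\mathrm{Tr}}+\lambda\mathbf I_0$ is invertible, and let $\dot{\widetilde{\mathbf B}}=(\widetilde{\mathbf X}_{\mathrm{Tr}}^\top\widetilde{\mathbf X}_{\mathrm{Tr}}+\lambda\mathbf I_0)^{-1}\widetilde{\mathbf X}_{\mathrm{Tr}}^\top\mathbf Y_{\mathrm{Tr}}$ be the weights of the regression retrained on the training set, and $\dot{\mathbf B}$ the matrix $\dot{\widetilde{\mathbf B}}$ without its last (bias) row. **Step 1.** The matrices $\widetilde{\mathbf X}^\top\widetilde{\mathbf X}+\lambda\mathbf I_0$ and $\mathbf I-\mathbf H_{\mathrm{Te}}$ are invertible; $\dot{\widetilde{\mathbf B}}$ is the unique minimiser of $\|\widetilde{\mathbf X}_{\mathrm{Tr}}\widetilde{\mathbf B}-\mathbf Y_{\mathrm{Tr}}\|_F^2+\lambda\|\mathbf B\|_F^2$, where $\mathbf B$ denotes $\widetilde{\mathbf B}$ without its last row; and the matrices $$\dot{\mathbf Y}_{\mathrm{Te}}:=\mathbf Y_{\mathrm{Te}}-(\mathbf I-\mathbf H_{\mathrm{Te}})^{-1}\hat{\mathbf E}_{\mathrm{Te}},\qquad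 \dot{\mathbf Y}_{\mathrm{Tr}}:=\mathbf Y_{\mathrm{Tr}}-\hat{\mathbf E}_{\mathrm{Tr}}-\mathbf H_{\mathrm{Tr},\mathrm{Te}}(\mathbf I-\mathbf H_{\mathrm{Te}})^{-1}\hat{\mathbf E}_{\mathrm{Te}}$$ are the fits of the retrained model: $\dot{\mathbf Y}_{\mathrm{Te}}=\widetilde{\mathbf X}_{\mathrm{Te}}\dot{\widetilde{\mathbf B}}$ and $\dot{\mathbf Y}_{\mathrm{Tr}}=\widetilde{\mathbf X}_{\mathrm{Tr}}\dot{\widetilde{\mathbf B}}$. **Step 2.** Let $\mathbf S_b=\sum_j n_j(\mathbf m_j-\overline{\mathbf m})(\mathbf m_j-\overline{\mathbf m})^\top$ and $\mathbf S_w=\lambda\mathbf I+\sum_j\sum_{i\in\mathcal C_j}(\mathbf x_i-\mathbf m_j)(\mathbf x_i-\mathbf m_j)^\top$ be the between-classes and the (ridge-regularised) within-class scatter matrix of the training set. Assume moreover that every class occurs in the training set, that $\mathbf S_w$ is positive definite and that $\mathbf S_b$ has rank $C-1$. An *eigen-analysis* of $\dot{\mathbf Y}_{\mathrm{Tr}}^\top\mathbf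 Y_{\mathrm{Tr}}/N_{\mathrm{Tr}}$ means a matrix $\boldsymbol\Theta'\in\mathbb R^{C\times C}$ and $\alpha_1^2,\dots,\alpha_C^2$ with $$\tfrac1{N_{\mathrm{Tr}}}\dot{\mathbf Y}_{\mathrm{Tr}}^\top\mathbf Y_{\mathrm{Tr}}\boldsymbol\Theta'=\tfrac1{N_{\mathrm{Tr}}}\mathbf Y_{\mathrm{Tr}}^\top\mathbf Y_{\mathrm{Tr}}\boldsymbol\Theta'\,\mathrm{diag}(\alpha_1^2,\dots,\alpha_C^2),\qquad \boldsymbol\Theta'^\top\big(\tfrac1{N_{\mathrm{Tr}}}\mathbf Y_{\mathrm{Tr}}^\top\mathbf Y_{\mathrm{Tr}}\big)\boldsymbol\Theta'=\mathbf I ,$$ that is, eigenvectors in the metric of the optimal-scoring constraint $N_{\mathrm{Tr}}^{-1}\|\mathbf Y_{\mathrm{Tr}}\boldsymbol\theta\|^2=1$. Then: 1. An eigen-analysis exists. In each of them exactly one eigenvalue equals $1$ (the trivial one) and all others lie strictly between $0$ and $1$. For every $k$, the pair $(\dot{\widetilde{\mathbf B}}\boldsymbol\theta_k,\boldsymbol\theta_k)$,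 with $\boldsymbol\theta_k$ the $k$-th column of $\boldsymbol\Theta'$, minimises $\|\widetilde{\mathbf X}_{\mathrm{Tr}}\boldsymbol\beta-\mathbf Y_{\mathrm{Tr}}\boldsymbol\theta\|^2+\lambda\|\mathbf w\|^2$ (where $\mathbf w$ is $\boldsymbol\beta$ without its last entry) over all $(\boldsymbol\beta,\boldsymbol\theta)$ with $N_{\mathrm{Tr}}^{-1}\|\mathbf Y_{\mathrm{Tr}}\boldsymbol\theta\|^2=1$ and $(\mathbf Y_{\mathrm{Tr}}\boldsymbol\theta_l)^\top\mathbf Y_{\mathrm{Tr}}\boldsymbol\theta=0$ for all $l$ with $\alpha_l^2>\alpha_k^2$. 2. Let $\dot{\boldsymbol\Theta}\in\mathbb R^{C\times(C-1)}$ be $\boldsymbol\Theta'$ without the column of the eigenvalue $1$, and $\dot{\mathbf D}=\sqrt{N_{\mathrm{Tr}}}^{\,-1}\,\mathrm{diag}\big(\sqrt{\alpha_k^2(1-\alpha_k^2)}\big)^{-1}$ over the remaining eigenvalues. Then $\dot{\mathbf W}:=\dot{\mathbf B}\dot{\boldsymbol\Theta}\dot{\mathbf D}$ is a matrix of discriminant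 coordinates of LDA retrained on the training set: $\mathbf S_b\dot{\mathbf W}=\mathbf S_w\dot{\mathbf W}\boldsymbol\Lambda$ with $\boldsymbol\Lambda$ diagonal with non-zero diagonal entries, and $\dot{\mathbf W}^\top\mathbf S_w\dot{\mathbf W}=\mathbf I$. Conversely, every $\mathbf W\in\mathbb R^{P\times(C-1)}$ with these two properties equals $\dot{\mathbf B}\dot{\boldsymbol\Theta}\dot{\mathbf D}$ for some eigen-analysis. 3. The scores $\dot{\mathbf Y}_{\mathrm{Te}}\dot{\boldsymbol\Theta}\dot{\mathbf D}$ are the retrained LDA discriminant scores $\mathbf X_{\mathrm{Te}}\dot{\mathbf W}$ up to a constant shift due to the bias: there is $\mathbf b\in\mathbb R^{C-1}$ with $\dot{\mathbf Y}_{\mathrm{Te}}\dot{\boldsymbol\Theta}\dot{\mathbf D}=\mathbf X_{\mathrm{Te}}\dot{\mathbf W}+\mathbf 1\mathbf b^\top$ and $\dot{\mathbf Y}_{\mathrm{Tr}}\dot{\boldsymbol\Theta}\dot{\mathbf D}=\mathbf X_{\mathrm{Tr}}\dot{\mathbf W}+\mathbf 1\mathbf b^\top$. Consequently the Euclidean distance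 of each test sample's score to each class centroid (the mean of the training scores of that class) is the same for both. -/

import Mathlib

open Matrix

noncomputable section

namespace MultiLDA

/-! Data: rows of `X : Matrix n p ℝ` are samples and columns are features; `y : n → κ` assigns a
class to each sample.  All notions are defined for an arbitrary finite sample set `n`, so that they
can be applied both to the full data set and to a training set. -/

variable {n p κ d : Type*}

/-- The augmented data matrix `[X, 1]`; the index `Sum.inr ()` is the bias column. -/
def augment (X : Matrix n p ℝ) : Matrix n (p ⊕ Unit) ℝ :=
  Matrix.fromCols X (Matrix.of fun _ _ => 1)

/-- The identity matrix with its last (bias) diagonal entry replaced by `0`. -/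
def biasFreeId (p : Type*) [DecidableEq p] : Matrix (p ⊕ Unit) (p ⊕ Unit) ℝ :=
  Matrix.diagonal (Sum.elim (fun _ => 1) (fun _ => 0))

/-- The (ridge-regularised) scatter matrix `[X,1]ᵀ [X,1] + lam I₀` of the augmented data. -/
def regScatter [Fintype n] [DecidableEq p] (X : Matrix n p ℝ) (lam : ℝ) :
    Matrix (p ⊕ Unit) (p ⊕ Unit) ℝ :=
  (augment X)ᵀ * augment X + lam • biasFreeId p

/-- The hat matrix; it depends on the features only. -/
def hatMatrix [Fintype n] [Fintype p] [DecidableEq p] (X : Matrix n p ℝ) (lam : ℝ) :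
    Matrix n n ℝ :=
  augment X * (regScatter X lam)⁻¹ * (augment X)ᵀ

/-- The objective `‖[X,1] B - Y‖_F² + lam ‖B without its bias row‖_F²` of (ridge) regression. -/
def regLoss [Fintype n] [Fintype p] [Fintype κ] (X : Matrix n p ℝ) (lam : ℝ) (Y : Matrix n κ ℝ)
    (B : Matrix (p ⊕ Unit) κ ℝ) : ℝ :=
  (∑ i, ∑ j, ((augment X * B - Y) i j) ^ 2) + lam * ∑ q, ∑ j, (B (Sum.inl q) j) ^ 2

/-- The regression weights `([X,1]ᵀ [X,1] + lam I₀)⁻¹ [X,1]ᵀ Y` (a model trained on `X`, `Y`). -/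
def regWeights [Fintype n] [Fintype p] [DecidableEq p] (X : Matrix n p ℝ) (lam : ℝ)
    (Y : Matrix n κ ℝ) : Matrix (p ⊕ Unit) κ ℝ :=
  (regScatter X lam)⁻¹ * (augment X)ᵀ * Y

/-- A weight matrix with the bias row omitted. -/
def dropBias (B : Matrix (p ⊕ Unit) κ ℝ) : Matrix p κ ℝ :=
  B.submatrix Sum.inl id

/-- The class indicator matrix. -/
def indicatorMatrix [DecidableEq κ] (y : n → κ) : Matrix n κ ℝ :=
  Matrix.of fun i j => if y i = j then 1 else 0

/-! ### Linear discriminant analysis -/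

/-- The number of samples in class `j`. -/
def classCount [Fintype n] [DecidableEq κ] (y : n → κ) (j : κ) : ℕ :=
  (Finset.univ.filter fun i => y i = j).card

/-- The mean (centroid) of the rows of `X` that belong to class `j`. -/
def classMean [Fintype n] [DecidableEq κ] (X : Matrix n p ℝ) (y : n → κ) (j : κ) : p → ℝ :=
  (classCount y j : ℝ)⁻¹ • ∑ i with y i = j, X i

/-- The mean of all rows of `X`. -/
def sampleMean [Fintype n] (X : Matrix n p ℝ) : p → ℝ :=
  (Fintype.card n : ℝ)⁻¹ • ∑ i, X i

/-- The between-classes scatter matrix. -/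
def betweenScatter [Fintype n] [Fintype κ] [DecidableEq κ] (X : Matrix n p ℝ) (y : n → κ) :
    Matrix p p ℝ :=
  ∑ j, (classCount y j : ℝ) •
    Matrix.vecMulVec (classMean X y j - sampleMean X) (classMean X y j - sampleMean X)

/-- The within-class scatter matrix. -/
def withinScatter [Fintype n] [Fintype κ] [DecidableEq κ] (X : Matrix n p ℝ) (y : n → κ) :
    Matrix p p ℝ :=
  ∑ j, ∑ i with y i = j, Matrix.vecMulVec (X i - classMean X y j) (X i - classMean X y j)

/-- The columns of `W` are discriminant coordinates for the scatter matrices `Sb`, `Sw`: they solve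
the generalised eigenvalue problem `Sb W = Sw W Λ` with non-zero eigenvalues, and are scaled such
that `Wᵀ Sw W = I`. -/
def IsDiscriminantCoordinates [Fintype p] [Fintype d] [DecidableEq d] (Sb Sw : Matrix p p ℝ)
    (W : Matrix p d ℝ) : Prop :=
  ∃ Λ : d → ℝ, (∀ k, Λ k ≠ 0) ∧ Sb * W = Sw * W * Matrix.diagonal Λ ∧ Wᵀ * Sw * W = 1

/-! ### Optimal scoring -/

/-- Eigen-analysis of `Yfitᵀ Y / N` in optimal scoring, `N` being the number of samples: the columns
of `Θ` are eigenvectors with eigenvalues `a k` (written `α_k²` in the literature), with respect to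
the inner product of the optimal-scoring constraint `N⁻¹ ‖Y θ‖² = 1`, and are orthonormal for it. -/
structure IsEigenAnalysis [Fintype n] [Fintype κ] [DecidableEq κ] (Yfit Y : Matrix n κ ℝ)
    (Θ : Matrix κ κ ℝ) (a : κ → ℝ) : Prop where
  eigen : ((Fintype.card n : ℝ)⁻¹ • (Yfitᵀ * Y)) * Θ =
    ((Fintype.card n : ℝ)⁻¹ • (Yᵀ * Y)) * Θ * Matrix.diagonal a
  orthonormal : Θᵀ * ((Fintype.card n : ℝ)⁻¹ • (Yᵀ * Y)) * Θ = 1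

/-- The optimal scoring objective `‖[X,1] β - Y θ‖² + lam ‖β without its bias entry‖²`. -/
def osLoss [Fintype n] [Fintype p] [Fintype κ] (X : Matrix n p ℝ) (lam : ℝ) (Y : Matrix n κ ℝ)
    (β : p ⊕ Unit → ℝ) (θ : κ → ℝ) : ℝ :=
  (∑ i, ((augment X *ᵥ β) i - (Y *ᵥ θ) i) ^ 2) + lam * ∑ q, β (Sum.inl q) ^ 2

/-- The scores admissible at stage `k` of optimal scoring: `N⁻¹ ‖Y θ‖² = 1`, and `Y θ` is
orthogonal to all `Y Θ_l` of earlier stages, that is, with a larger eigenvalue. -/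
def admissibleScores [Fintype n] [Fintype κ] (Y : Matrix n κ ℝ) (Θ : Matrix κ κ ℝ) (a : κ → ℝ)
    (k : κ) : Set (κ → ℝ) :=
  {θ | (Fintype.card n : ℝ)⁻¹ * ∑ i, (Y *ᵥ θ) i ^ 2 = 1 ∧
    ∀ l, a k < a l → (Y *ᵥ Θ.col l) ⬝ᵥ (Y *ᵥ θ) = 0}

/-- The diagonal scaling matrix `√N⁻¹ diag(√(α_k² (1 - α_k²)))⁻¹`, where `a k = α_k²`. -/
def scalingMatrix [Fintype d] [DecidableEq d] (N : ℕ) (a : d → ℝ) : Matrix d d ℝ :=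
  (Real.sqrt N)⁻¹ • (Matrix.diagonal fun k => Real.sqrt (a k * (1 - a k)))⁻¹

/-- The matrix of scores with the column `j₀` removed. -/
def dropCol {c : ℕ} (Θ : Matrix (Fin (c + 1)) (Fin (c + 1)) ℝ) (j₀ : Fin (c + 1)) :
    Matrix (Fin (c + 1)) (Fin c) ℝ :=
  Θ.submatrix id j₀.succAbove

/-- `Θ D`: the scores without the column `j₀`, times the scaling matrix. -/
def scaledScores {c : ℕ} (N : ℕ) (Θ : Matrix (Fin (c + 1)) (Fin (c + 1)) ℝ)
    (a : Fin (c + 1) → ℝ) (j₀ : Fin (c + 1)) : Matrix (Fin (c + 1)) (Fin c) ℝ :=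
  dropCol Θ j₀ * scalingMatrix N fun k => a (j₀.succAbove k)

/-! ### The update rule

`Te` is the set of test samples; all other samples are training samples.  Everything below is
computed from a hat matrix `H` and responses `Y` of the full data set. -/

/-- The rows of the test samples. -/
def testRows (Te : Finset n) (A : Matrix n κ ℝ) : Matrix {i // i ∈ Te} κ ℝ :=
  A.submatrix Subtype.val id

/-- The rows of the training samples. -/
def trainRows (Te : Finset n) (A : Matrix n κ ℝ) : Matrix {i // i ∉ Te} κ ℝ :=
  A.submatrix Subtype.val id

/-- The rows and columns of `H` that correspond to test samples. -/
def hatTest (Te : Finset n) (H : Matrix n n ℝ) : Matrix {i // i ∈ Te} {i // i ∈ Te} ℝ :=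
  H.submatrix Subtype.val Subtype.val

/-- The rows of `H` for training samples and columns for test samples. -/
def hatTrainTest (Te : Finset n) (H : Matrix n n ℝ) : Matrix {i // i ∉ Te} {i // i ∈ Te} ℝ :=
  H.submatrix Subtype.val Subtype.val

/-- Cross-validated errors on the test set, `(I - H_Te)⁻¹ E_Te` with `E = Y - H Y`. -/
def cvErrTest [Fintype n] [DecidableEq n] (H : Matrix n n ℝ) (Y : Matrix n κ ℝ) (Te : Finset n) :
    Matrix {i // i ∈ Te} κ ℝ :=
  (1 - hatTest Te H)⁻¹ * testRows Te (Y - H * Y)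

/-- Cross-validated errors on the training set, `E_Tr + H_{Tr,Te} (I - H_Te)⁻¹ E_Te`. -/
def cvErrTrain [Fintype n] [DecidableEq n] (H : Matrix n n ℝ) (Y : Matrix n κ ℝ) (Te : Finset n) :
    Matrix {i // i ∉ Te} κ ℝ :=
  trainRows Te (Y - H * Y) +
    hatTrainTest Te H * (1 - hatTest Te H)⁻¹ * testRows Te (Y - H * Y)

/-- Cross-validated regression fits on the test set. -/
def cvFitTest [Fintype n] [DecidableEq n] (H : Matrix n n ℝ) (Y : Matrix n κ ℝ) (Te : Finset n) :
    Matrix {i // i ∈ Te} κ ℝ :=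
  testRows Te Y - cvErrTest H Y Te

/-- Cross-validated regression fits on the training set. -/
def cvFitTrain [Fintype n] [DecidableEq n] (H : Matrix n n ℝ) (Y : Matrix n κ ℝ) (Te : Finset n) :
    Matrix {i // i ∉ Te} κ ℝ :=
  trainRows Te Y - cvErrTrain H Y Te

end MultiLDA

end

open MultiLDA

set_option linter.unusedSectionVars false

namespace MultiLDA

variable {n p κ d : Type*}

/-! Write G for the regularised scatter matrix of the augmented data, and mark training quantities
by Tr. Step 1 rests on G = G_Tr + X̃_Teᵀ X̃_Te. The full-data weights therefore differ from the
retrained ones by G⁻¹ X̃_Teᵀ R, where R is the test residual of the retrained model. Applying X̃_Te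
gives Ê_Te = (I − H_Te) R, and applying X̃_Tr gives the training fits. The identity det(I − H_Te) =
det(G⁻¹ G_Tr) makes the inverse legitimate.

In Step 2 everything lives on the training set. Let M = YᵀY (the diagonal of class sizes), K =
`fitCross`, and let C = `centredMeans` have the centred class means as rows, so that S_b = CᵀMC. The
ridge does not penalise the bias, so constant scores are fitted exactly and K1 = M1: this is the
trivial eigenvalue. For scores θ with Σ n_j θ_j = 0 the bias can be eliminated
(`normal_equations_iff`), and the weights w of θ satisfy (S_w + S_b) w = CᵀMθ and Kθ = MCw. If
moreover Kθ = aMθ, then Cw = aθ, whence (1 − a) S_b w = a S_w w and wᵀ S_w w' = a(1 − a') θᵀMθ'. The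
first identity turns scores into discriminant coordinates with eigenvalue a/(1 − a). The second
explains the scaling by √(N a(1 − a)) and, since S_w is positive definite, confines a to (0, 1). The
rank condition is what guarantees w ≠ 0.

The converse reads these identities backwards, recovering θ as a multiple of Cw. Optimality of the
scores is the Rayleigh principle for K relative to M, because minimising the objective over β leaves
‖Yθ‖² − θᵀKθ. -/

theorem augment_mulVec [Fintype p] (X : Matrix n p ℝ) (β : p ⊕ Unit → ℝ) (i : n) :
    (augment X *ᵥ β) i = (X *ᵥ (β ∘ Sum.inl)) i + β (Sum.inr ()) := by
  simp [augment, Matrix.mulVec, dotProduct, Matrix.fromCols]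

theorem augment_mul [Fintype p] (X : Matrix n p ℝ) (B : Matrix (p ⊕ Unit) κ ℝ) (i : n) (j : κ) :
    (augment X * B) i j = (X * dropBias B) i j + B (Sum.inr ()) j := by
  simp [augment, Matrix.mul_apply, Matrix.fromCols, dropBias]

theorem regScatter_isSymm [Fintype n] [DecidableEq p] (X : Matrix n p ℝ) (lam : ℝ) :
    (regScatter X lam)ᵀ = regScatter X lam := by
  simp [regScatter, biasFreeId, Matrix.transpose_add, Matrix.transpose_mul]

theorem testRows_augment (Te : Finset n) (X : Matrix n p ℝ) :
    testRows Te (augment X) = augment (testRows Te X) := by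
  ext i (q | q) <;> rfl

theorem trainRows_augment (Te : Finset n) (X : Matrix n p ℝ) :
    trainRows Te (augment X) = augment (trainRows Te X) := by
  ext i (q | q) <;> rfl

theorem hatMatrix_mul [Fintype n] [Fintype p] [DecidableEq p] (X : Matrix n p ℝ) (lam : ℝ)
    (Y : Matrix n κ ℝ) :
    hatMatrix X lam * Y = augment X * regWeights X lam Y := by
  simp only [hatMatrix, regWeights, Matrix.mul_assoc]

/-! ### Ridge regression with an unpenalised bias -/

section Ridge

variable [Fintype n] [Fintype p] [DecidableEq p]

theorem regScatter_inv_transpose (X : Matrix n p ℝ) (lam : ℝ) :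
    ((regScatter X lam)⁻¹)ᵀ = (regScatter X lam)⁻¹ := by
  rw [Matrix.transpose_nonsing_inv, regScatter_isSymm]

theorem posSemidef_regScatter (X : Matrix n p ℝ) {lam : ℝ} (hlam : 0 ≤ lam) :
    (regScatter X lam).PosSemidef := by
  unfold regScatter
  refine Matrix.PosSemidef.add ?_ ?_
  · simpa using Matrix.posSemidef_conjTranspose_mul_self (augment X)
  · refine Matrix.PosSemidef.smul ?_ hlam
    unfold biasFreeId
    rw [Matrix.posSemidef_diagonal_iff]
    rintro (i | i) <;> simp

theorem posDef_regScatter (X : Matrix n p ℝ) {lam : ℝ} (hlam : 0 ≤ lam)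
    (h : IsUnit (regScatter X lam).det) : (regScatter X lam).PosDef :=
  ((posSemidef_regScatter X hlam).posDef_iff_isUnit).2 ((Matrix.isUnit_iff_isUnit_det _).2 h)

theorem regScatter_mul_regWeights (X : Matrix n p ℝ) {lam : ℝ}
    (h : IsUnit (regScatter X lam).det) (Y : Matrix n κ ℝ) :
    regScatter X lam * regWeights X lam Y = (augment X)ᵀ * Y := by
  rw [regWeights, Matrix.mul_assoc, Matrix.mul_nonsing_inv_cancel_left _ _ h]

/-- Normal equations with invertible matrix have one solution, so weights for a score vector can be
guessed and then verified. -/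
theorem regWeights_mulVec_eq [Fintype κ] (X : Matrix n p ℝ) {lam : ℝ}
    (h : IsUnit (regScatter X lam).det) (Y : Matrix n κ ℝ) (θ : κ → ℝ) (β : p ⊕ Unit → ℝ)
    (hβ : regScatter X lam *ᵥ β = (augment X)ᵀ *ᵥ (Y *ᵥ θ)) :
    regWeights X lam Y *ᵥ θ = β := by
  rw [regWeights, Matrix.mul_assoc, ← Matrix.mulVec_mulVec, ← Matrix.mulVec_mulVec, ← hβ,
    Matrix.mulVec_mulVec, Matrix.nonsing_inv_mul _ h, Matrix.one_mulVec]

theorem dotProduct_regScatter (X : Matrix n p ℝ) (lam : ℝ) (β γ : p ⊕ Unit → ℝ) :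
    β ⬝ᵥ (regScatter X lam *ᵥ γ) =
      (augment X *ᵥ β) ⬝ᵥ (augment X *ᵥ γ) + lam * ∑ q, β (Sum.inl q) * γ (Sum.inl q) := by
  rw [regScatter, Matrix.add_mulVec, dotProduct_add, ← Matrix.mulVec_mulVec,
    Matrix.dotProduct_mulVec, Matrix.vecMul_transpose, Matrix.smul_mulVec, dotProduct_smul,
    smul_eq_mul]
  congr 2
  simp [dotProduct, biasFreeId, Matrix.mulVec_diagonal]

/-- The ridge objective is its value at the stationary point plus the quadratic form of the
regularised scatter matrix. -/
theorem ridge_loss_eq (X : Matrix n p ℝ) (lam : ℝ) (v : n → ℝ) (β γ : p ⊕ Unit → ℝ)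
    (hγ : regScatter X lam *ᵥ γ = (augment X)ᵀ *ᵥ v) :
    (∑ i, ((augment X *ᵥ β) i - v i) ^ 2) + lam * ∑ q, β (Sum.inl q) ^ 2 =
      ((∑ i, ((augment X *ᵥ γ) i - v i) ^ 2) + lam * ∑ q, γ (Sum.inl q) ^ 2) +
        (β - γ) ⬝ᵥ (regScatter X lam *ᵥ (β - γ)) := by
  have h1 : (β - γ) ⬝ᵥ (regScatter X lam *ᵥ γ) = (augment X *ᵥ (β - γ)) ⬝ᵥ v := by
    rw [hγ, Matrix.dotProduct_mulVec, Matrix.vecMul_transpose]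
  rw [dotProduct_regScatter] at h1 ⊢
  simp only [Matrix.mulVec_sub, dotProduct, Pi.sub_apply] at h1 ⊢
  have e1 : (∑ i, ((augment X *ᵥ β) i - v i) ^ 2) - (∑ i, ((augment X *ᵥ γ) i - v i) ^ 2) =
      (∑ i, ((augment X *ᵥ β) i - (augment X *ᵥ γ) i) * ((augment X *ᵥ β) i - (augment X *ᵥ γ) i))
      + 2 * (∑ i, ((augment X *ᵥ β) i - (augment X *ᵥ γ) i) * (augment X *ᵥ γ) i)
      - 2 * (∑ i, ((augment X *ᵥ β) i - (augment X *ᵥ γ) i) * v i) := by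
    rw [Finset.mul_sum, Finset.mul_sum, ← Finset.sum_sub_distrib, ← Finset.sum_add_distrib,
      ← Finset.sum_sub_distrib]
    exact Finset.sum_congr rfl fun i _ => by ring
  have e2 : (∑ q, β (Sum.inl q) ^ 2) - (∑ q, γ (Sum.inl q) ^ 2) =
      (∑ q, (β (Sum.inl q) - γ (Sum.inl q)) * (β (Sum.inl q) - γ (Sum.inl q)))
      + 2 * (∑ q, (β (Sum.inl q) - γ (Sum.inl q)) * γ (Sum.inl q)) := by
    rw [Finset.mul_sum, ← Finset.sum_sub_distrib, ← Finset.sum_add_distrib]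
    exact Finset.sum_congr rfl fun i _ => by ring
  linear_combination e1 + lam * e2 + 2 * h1

theorem regLoss_eq [Fintype κ] (X : Matrix n p ℝ) {lam : ℝ}
    (h : IsUnit (regScatter X lam).det) (Y : Matrix n κ ℝ) (B : Matrix (p ⊕ Unit) κ ℝ) :
    regLoss X lam Y B = regLoss X lam Y (regWeights X lam Y) +
      ∑ j, ((B - regWeights X lam Y).col j) ⬝ᵥ
        (regScatter X lam *ᵥ (B - regWeights X lam Y).col j) := by
  have key : ∀ B : Matrix (p ⊕ Unit) κ ℝ, regLoss X lam Y B =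
      ∑ j, ((∑ i, ((augment X *ᵥ B.col j) i - Y.col j i) ^ 2) +
        lam * ∑ q, B.col j (Sum.inl q) ^ 2) := by
    intro B
    rw [regLoss, Finset.sum_comm, Finset.sum_comm (s := (Finset.univ : Finset p)),
      Finset.sum_add_distrib, Finset.mul_sum]
    rfl
  rw [key, key, ← Finset.sum_add_distrib]
  refine Finset.sum_congr rfl fun j _ => ?_
  refine ridge_loss_eq X lam (Y.col j) (B.col j) ((regWeights X lam Y).col j) ?_
  have := regScatter_mul_regWeights X h Y
  ext q
  exact congrFun (congrFun this q) j

theorem regLoss_minimiser_iff [Fintype κ] (X : Matrix n p ℝ) {lam : ℝ} (hlam : 0 ≤ lam)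
    (h : IsUnit (regScatter X lam).det) (Y : Matrix n κ ℝ) (B : Matrix (p ⊕ Unit) κ ℝ) :
    (∀ B', regLoss X lam Y B ≤ regLoss X lam Y B') ↔ B = regWeights X lam Y := by
  have hpos := posDef_regScatter X hlam h
  have hnn : ∀ x : p ⊕ Unit → ℝ, 0 ≤ x ⬝ᵥ (regScatter X lam *ᵥ x) := fun x => by
    simpa using hpos.posSemidef.dotProduct_mulVec_nonneg x
  constructor
  · intro hB
    have h1 := hB (regWeights X lam Y)
    rw [regLoss_eq X h Y B] at h1
    have h2 : ∑ j, ((B - regWeights X lam Y).col j) ⬝ᵥ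
        (regScatter X lam *ᵥ (B - regWeights X lam Y).col j) = 0 :=
      le_antisymm (by linarith) (Finset.sum_nonneg fun j _ => hnn _)
    rw [Finset.sum_eq_zero_iff_of_nonneg fun j _ => hnn _] at h2
    rw [← sub_eq_zero]
    ext q j
    by_contra hne
    have h3 : (B - regWeights X lam Y).col j ≠ 0 := fun h0 => hne (congrFun h0 q)
    have := hpos.dotProduct_mulVec_pos h3
    simp [h2 j (Finset.mem_univ j)] at this
  · rintro rfl B'
    rw [regLoss_eq X h Y B']
    exact le_add_of_nonneg_right (Finset.sum_nonneg fun j _ => hnn _)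

theorem osLoss_regWeights_le [Fintype κ] (X : Matrix n p ℝ) {lam : ℝ} (hlam : 0 ≤ lam)
    (h : IsUnit (regScatter X lam).det) (Y : Matrix n κ ℝ) (β : p ⊕ Unit → ℝ) (θ : κ → ℝ) :
    osLoss X lam Y (regWeights X lam Y *ᵥ θ) θ ≤ osLoss X lam Y β θ := by
  have hγ : regScatter X lam *ᵥ (regWeights X lam Y *ᵥ θ) = (augment X)ᵀ *ᵥ (Y *ᵥ θ) := by
    rw [Matrix.mulVec_mulVec, regScatter_mul_regWeights X h, Matrix.mulVec_mulVec]
  rw [osLoss, osLoss, ridge_loss_eq X lam (Y *ᵥ θ) β _ hγ]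
  refine le_add_of_nonneg_right ?_
  simpa using (posSemidef_regScatter X hlam).dotProduct_mulVec_nonneg
    (β - regWeights X lam Y *ᵥ θ)

theorem osLoss_regWeights [Fintype κ] (X : Matrix n p ℝ) {lam : ℝ}
    (h : IsUnit (regScatter X lam).det) (Y : Matrix n κ ℝ) (θ : κ → ℝ) :
    osLoss X lam Y (regWeights X lam Y *ᵥ θ) θ =
      ∑ i, (Y *ᵥ θ) i ^ 2 -
        θ ⬝ᵥ (((augment X * regWeights X lam Y)ᵀ * Y) *ᵥ θ) := by
  have hγ : regScatter X lam *ᵥ (regWeights X lam Y *ᵥ θ) = (augment X)ᵀ *ᵥ (Y *ᵥ θ) := by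
    rw [Matrix.mulVec_mulVec, regScatter_mul_regWeights X h, Matrix.mulVec_mulVec]
  -- At β = 0 the loss is ‖Yθ‖², so the quadratic form of the optimal weights is exactly what the
  -- fit gains over no fit at all.
  have h1 := ridge_loss_eq X lam (Y *ᵥ θ) 0 _ hγ
  rw [osLoss]
  have h2 : (0 - regWeights X lam Y *ᵥ θ) ⬝ᵥ
      (regScatter X lam *ᵥ (0 - regWeights X lam Y *ᵥ θ)) =
      θ ⬝ᵥ (((augment X * regWeights X lam Y)ᵀ * Y) *ᵥ θ) := by
    rw [zero_sub, Matrix.mulVec_neg, neg_dotProduct_neg, hγ, Matrix.dotProduct_mulVec,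
      Matrix.vecMul_transpose, ← Matrix.mulVec_mulVec, Matrix.dotProduct_mulVec θ,
      Matrix.vecMul_transpose, Matrix.mulVec_mulVec]
  rw [h2] at h1
  simp only [Matrix.mulVec_zero, Pi.zero_apply, zero_sub, neg_sq, ne_eq, OfNat.ofNat_ne_zero,
    not_false_eq_true, zero_pow, Finset.sum_const_zero, mul_zero, add_zero] at h1
  linarith

end Ridge

/-! ### Removing the test samples from the regression -/

section Update

variable [Fintype n] [DecidableEq n] [Fintype p] [DecidableEq p]

theorem sum_test_add_sum_train (Te : Finset n) (f : n → ℝ) :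
    ∑ i, f i = ∑ i : {i // i ∉ Te}, f i + ∑ i : {i // i ∈ Te}, f i := by
  rw [add_comm]
  convert (Fintype.sum_subtype_add_sum_subtype (fun i => i ∈ Te) f).symm

theorem transpose_mul_eq_train_add_test (Te : Finset n) (A : Matrix n d ℝ) (Y : Matrix n κ ℝ) :
    Aᵀ * Y = (trainRows Te A)ᵀ * trainRows Te Y + (testRows Te A)ᵀ * testRows Te Y := by
  ext q j
  simp only [Matrix.mul_apply, Matrix.add_apply, Matrix.transpose_apply, trainRows, testRows,
    Matrix.submatrix_apply, id]
  exact sum_test_add_sum_train Te fun i => A i q * Y i j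

theorem regScatter_eq_train_add_test (Te : Finset n) (X : Matrix n p ℝ) (lam : ℝ) :
    regScatter X lam = regScatter (trainRows Te X) lam +
      (augment (testRows Te X))ᵀ * augment (testRows Te X) := by
  rw [regScatter, transpose_mul_eq_train_add_test Te, trainRows_augment, testRows_augment,
    regScatter]
  abel

theorem isUnit_det_regScatter (Te : Finset n) (X : Matrix n p ℝ) {lam : ℝ} (hlam : 0 ≤ lam)
    (h : IsUnit (regScatter (trainRows Te X) lam).det) : IsUnit (regScatter X lam).det := by
  rw [← Matrix.isUnit_iff_isUnit_det, regScatter_eq_train_add_test Te]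
  refine ((posDef_regScatter _ hlam h).add_posSemidef ?_).isUnit
  simpa using Matrix.posSemidef_conjTranspose_mul_self (augment (testRows Te X))

theorem hatTest_hatMatrix (Te : Finset n) (X : Matrix n p ℝ) (lam : ℝ) :
    hatTest Te (hatMatrix X lam) =
      augment (testRows Te X) * (regScatter X lam)⁻¹ * (augment (testRows Te X))ᵀ := by
  rw [← testRows_augment]; rfl

theorem hatTrainTest_hatMatrix (Te : Finset n) (X : Matrix n p ℝ) (lam : ℝ) :
    hatTrainTest Te (hatMatrix X lam) =
      augment (trainRows Te X) * (regScatter X lam)⁻¹ * (augment (testRows Te X))ᵀ := by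
  rw [← testRows_augment, ← trainRows_augment]; rfl

/-- By det(1 − AB) = det(1 − BA) the question moves from sample space to feature space, where the
matrix becomes G⁻¹ G_Tr, a product of two invertible matrices. -/
theorem isUnit_det_one_sub_hatTest (Te : Finset n) (X : Matrix n p ℝ) {lam : ℝ} (hlam : 0 ≤ lam)
    (h : IsUnit (regScatter (trainRows Te X) lam).det) :
    IsUnit (1 - hatTest Te (hatMatrix X lam)).det := by
  have hG := isUnit_det_regScatter Te X hlam h
  rw [hatTest_hatMatrix, Matrix.mul_assoc, Matrix.det_one_sub_mul_comm]
  have h1 : 1 - (regScatter X lam)⁻¹ * (augment (testRows Te X))ᵀ * augment (testRows Te X) =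
      (regScatter X lam)⁻¹ * regScatter (trainRows Te X) lam := by
    rw [eq_sub_of_add_eq (regScatter_eq_train_add_test Te X lam).symm, Matrix.mul_sub,
      Matrix.nonsing_inv_mul _ hG, Matrix.mul_assoc]
  rw [h1, Matrix.det_mul]
  exact ((Matrix.isUnit_nonsing_inv_det_iff).2 hG).mul h

/-- The retrained weights violate the normal equations of the full data exactly by X̃_Teᵀ times
their test residuals; solving for this defect gives the correction. -/
theorem regWeights_eq_train_add (Te : Finset n) (X : Matrix n p ℝ) {lam : ℝ} (hlam : 0 ≤ lam)
    (h : IsUnit (regScatter (trainRows Te X) lam).det) (Y : Matrix n κ ℝ) :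
    regWeights X lam Y = regWeights (trainRows Te X) lam (trainRows Te Y) +
      (regScatter X lam)⁻¹ * (augment (testRows Te X))ᵀ * (testRows Te Y -
        augment (testRows Te X) * regWeights (trainRows Te X) lam (trainRows Te Y)) := by
  have hG := isUnit_det_regScatter Te X hlam h
  set B := regWeights (trainRows Te X) lam (trainRows Te Y) with hB
  have h1 : (augment X)ᵀ * Y = regScatter X lam * B + (augment (testRows Te X))ᵀ *
      (testRows Te Y - augment (testRows Te X) * B) := by
    rw [transpose_mul_eq_train_add_test Te, trainRows_augment, testRows_augment,
      ← regScatter_mul_regWeights _ h, ← hB, regScatter_eq_train_add_test Te, Matrix.add_mul,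
      Matrix.mul_sub, Matrix.mul_assoc]
    abel
  rw [regWeights, Matrix.mul_assoc, h1, Matrix.mul_add, Matrix.nonsing_inv_mul_cancel_left _ _ hG,
    Matrix.mul_assoc]

/-- Multiplying the weight correction by X̃_Te reproduces H_Te, so the full-data residuals on the
test set are (1 − H_Te) times the retrained ones. -/
theorem cvErrTest_hatMatrix (Te : Finset n) (X : Matrix n p ℝ) {lam : ℝ} (hlam : 0 ≤ lam)
    (h : IsUnit (regScatter (trainRows Te X) lam).det) (Y : Matrix n κ ℝ) :
    cvErrTest (hatMatrix X lam) Y Te = testRows Te Y -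
      augment (testRows Te X) * regWeights (trainRows Te X) lam (trainRows Te Y) := by
  have hu := isUnit_det_one_sub_hatTest Te X hlam h
  have h1 : testRows Te (Y - hatMatrix X lam * Y) = (1 - hatTest Te (hatMatrix X lam)) *
      (testRows Te Y -
        augment (testRows Te X) * regWeights (trainRows Te X) lam (trainRows Te Y)) := by
    have h2 : testRows Te (Y - hatMatrix X lam * Y) =
        testRows Te Y - augment (testRows Te X) * regWeights X lam Y := by
      rw [hatMatrix_mul, ← testRows_augment]; rfl
    rw [h2, regWeights_eq_train_add Te X hlam h, hatTest_hatMatrix, Matrix.sub_mul, Matrix.one_mul,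
      Matrix.mul_add]
    simp only [Matrix.mul_assoc]
    abel
  rw [cvErrTest, h1, Matrix.nonsing_inv_mul_cancel_left _ _ hu]

theorem cvFitTest_hatMatrix (Te : Finset n) (X : Matrix n p ℝ) {lam : ℝ} (hlam : 0 ≤ lam)
    (h : IsUnit (regScatter (trainRows Te X) lam).det) (Y : Matrix n κ ℝ) :
    cvFitTest (hatMatrix X lam) Y Te =
      augment (testRows Te X) * regWeights (trainRows Te X) lam (trainRows Te Y) := by
  rw [cvFitTest, cvErrTest_hatMatrix Te X hlam h, sub_sub_cancel]

theorem cvFitTrain_hatMatrix (Te : Finset n) (X : Matrix n p ℝ) {lam : ℝ} (hlam : 0 ≤ lam)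
    (h : IsUnit (regScatter (trainRows Te X) lam).det) (Y : Matrix n κ ℝ) :
    cvFitTrain (hatMatrix X lam) Y Te =
      augment (trainRows Te X) * regWeights (trainRows Te X) lam (trainRows Te Y) := by
  have h1 := cvErrTest_hatMatrix Te X hlam h Y
  have h2 : trainRows Te (Y - hatMatrix X lam * Y) =
      trainRows Te Y - augment (trainRows Te X) * regWeights X lam Y := by
    rw [hatMatrix_mul, ← trainRows_augment]; rfl
  rw [cvErrTest] at h1
  rw [cvFitTrain, cvErrTrain, Matrix.mul_assoc, h1, h2, regWeights_eq_train_add Te X hlam h,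
    hatTrainTest_hatMatrix, Matrix.mul_add]
  simp only [Matrix.mul_assoc]
  abel

end Update

/-! ### Class sizes, class means and the scatter decomposition -/

/-- The class sizes, as real numbers. -/
noncomputable def classWeight [Fintype n] [DecidableEq κ] (y : n → κ) (j : κ) : ℝ := classCount y j

/-- The matrix whose rows are the class means, centred at the overall mean. -/
noncomputable def centredMeans [Fintype n] [DecidableEq κ] (X : Matrix n p ℝ) (y : n → κ) :
    Matrix κ p ℝ :=
  Matrix.of fun j => classMean X y j - sampleMean X

/-- The cross product of fitted and observed class indicators, on which optimal scoring performs
its eigen-analysis. -/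
noncomputable def fitCross [Fintype n] [Fintype p] [DecidableEq p] [DecidableEq κ]
    (X : Matrix n p ℝ) (lam : ℝ) (y : n → κ) : Matrix κ κ ℝ :=
  (augment X * regWeights X lam (indicatorMatrix y))ᵀ * indicatorMatrix y

theorem indicatorMatrix_mulVec [Fintype κ] [DecidableEq κ] (y : n → κ) (θ : κ → ℝ) :
    indicatorMatrix y *ᵥ θ = fun i => θ (y i) := by
  ext i
  simp [indicatorMatrix, Matrix.mulVec, dotProduct]

section Counting

variable [Fintype n] [DecidableEq κ]

theorem indicatorMatrix_transpose_mulVec (y : n → κ) (v : n → ℝ) (j : κ) :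
    ((indicatorMatrix y)ᵀ *ᵥ v) j = ∑ i with y i = j, v i := by
  simp [indicatorMatrix, Matrix.mulVec, dotProduct, Finset.sum_filter]

theorem indicatorMatrix_transpose_mul_self (y : n → κ) :
    (indicatorMatrix y)ᵀ * indicatorMatrix y = Matrix.diagonal (classWeight y) := by
  ext j k
  rw [Matrix.mul_apply, Matrix.diagonal_apply]
  split_ifs with h
  · subst h
    simp [indicatorMatrix, classWeight, classCount, ← ite_and]
  · refine Finset.sum_eq_zero fun i _ => ?_
    simp only [indicatorMatrix, Matrix.transpose_apply, Matrix.of_apply, mul_ite, mul_one, mul_zero]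
    split_ifs with h1 h2
    · exact absurd (h2.symm.trans h1) h
    all_goals rfl

theorem sum_class_apply (X : Matrix n p ℝ) (y : n → κ) (j : κ) (q : p) :
    ∑ i with y i = j, X i q = classWeight y j * classMean X y j q := by
  simp only [classMean, Pi.smul_apply, smul_eq_mul, classWeight]
  -- For an empty class the mean has the default value 0, and both sides vanish.
  rcases eq_or_ne (classCount y j) 0 with h | h
  · rw [h]
    rw [classCount, Finset.card_eq_zero] at h
    simp [h]
  · field_simp
    exact (Finset.sum_apply q _ _).symm

theorem sum_rows_apply (X : Matrix n p ℝ) (q : p) :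
    ∑ i, X i q = (Fintype.card n : ℝ) * sampleMean X q := by
  simp only [sampleMean, Pi.smul_apply, smul_eq_mul]
  rcases isEmpty_or_nonempty n with h | h
  · simp
  · field_simp
    exact (Finset.sum_apply q _ _).symm

theorem sum_class_const (y : n → κ) (j : κ) (r : ℝ) :
    ∑ i with y i = j, r = classWeight y j * r := by
  simp [classWeight, classCount]

theorem sum_comp_label [Fintype κ] (y : n → κ) (θ : κ → ℝ) :
    ∑ i, θ (y i) = ∑ j, classWeight y j * θ j := by
  rw [← Finset.sum_fiberwise Finset.univ y]
  refine Finset.sum_congr rfl fun j _ => ?_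
  rw [← sum_class_const]
  refine Finset.sum_congr rfl fun i hi => ?_
  rw [(Finset.mem_filter.1 hi).2]

theorem sum_classWeight [Fintype κ] (y : n → κ) : ∑ j, classWeight y j = Fintype.card n := by
  have := sum_comp_label y (fun _ => (1 : ℝ))
  simpa using this.symm

theorem classWeight_pos {y : n → κ} (hy : ∀ j, ∃ i, y i = j) (j : κ) : 0 < classWeight y j := by
  obtain ⟨i, hi⟩ := hy j
  rw [classWeight, Nat.cast_pos, classCount, Finset.card_pos]
  exact ⟨i, by simp [hi]⟩

theorem betweenScatter_eq [Fintype κ] (X : Matrix n p ℝ) (y : n → κ) :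
    betweenScatter X y =
      (centredMeans X y)ᵀ * Matrix.diagonal (classWeight y) * centredMeans X y := by
  ext q r
  rw [Matrix.mul_apply]
  simp only [betweenScatter, Matrix.sum_apply, Matrix.smul_apply, Matrix.vecMulVec_apply,
    Matrix.mul_diagonal, Matrix.transpose_apply, centredMeans, Matrix.of_apply, Pi.sub_apply,
    smul_eq_mul, classWeight]
  exact Finset.sum_congr rfl fun j _ => by ring

/-- Classical analysis of variance: expanding each class's products about the class mean and about
the overall mean leaves the same terms once the class sums are inserted. -/
theorem within_add_betweenScatter_apply [Fintype κ] (X : Matrix n p ℝ) (y : n → κ) (q r : p) :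
    (withinScatter X y + betweenScatter X y) q r =
      ∑ i, (X i q - sampleMean X q) * (X i r - sampleMean X r) := by
  simp only [withinScatter, betweenScatter, Matrix.add_apply, Matrix.sum_apply, Matrix.smul_apply,
    Matrix.vecMulVec_apply, Pi.sub_apply, smul_eq_mul]
  rw [← Finset.sum_fiberwise Finset.univ y, ← Finset.sum_add_distrib]
  refine Finset.sum_congr rfl fun j _ => ?_
  have h1 := sum_class_apply X y j q
  have h2 := sum_class_apply X y j r
  have h3 := sum_class_const y j (classMean X y j q * classMean X y j r)
  have h4 := sum_class_const y j (sampleMean X q * sampleMean X r)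
  have e1 : ∑ i with y i = j, (X i q - classMean X y j q) * (X i r - classMean X y j r) =
      ∑ i with y i = j, X i q * X i r - classMean X y j r * ∑ i with y i = j, X i q -
        classMean X y j q * ∑ i with y i = j, X i r +
        ∑ i with y i = j, classMean X y j q * classMean X y j r := by
    rw [Finset.mul_sum, Finset.mul_sum, ← Finset.sum_sub_distrib, ← Finset.sum_sub_distrib,
      ← Finset.sum_add_distrib]
    exact Finset.sum_congr rfl fun i _ => by ring
  have e2 : ∑ i with y i = j, (X i q - sampleMean X q) * (X i r - sampleMean X r) =
      ∑ i with y i = j, X i q * X i r - sampleMean X r * ∑ i with y i = j, X i q -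
        sampleMean X q * ∑ i with y i = j, X i r +
        ∑ i with y i = j, sampleMean X q * sampleMean X r := by
    rw [Finset.mul_sum, Finset.mul_sum, ← Finset.sum_sub_distrib, ← Finset.sum_sub_distrib,
      ← Finset.sum_add_distrib]
    exact Finset.sum_congr rfl fun i _ => by ring
  rw [e1, e2, h1, h2, h3, h4, classWeight]
  ring

theorem sum_classWeight_mul_centredMeans [Fintype κ] (X : Matrix n p ℝ) (y : n → κ) (q : p) :
    ∑ j, classWeight y j * centredMeans X y j q = 0 := by
  simp only [centredMeans, Matrix.of_apply, Pi.sub_apply, mul_sub, Finset.sum_sub_distrib,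
    ← sum_class_apply, ← Finset.sum_mul, sum_classWeight]
  rw [Finset.sum_fiberwise, sum_rows_apply, sub_self]

end Counting

theorem sum_mulVec [Fintype n] [Fintype p]
    (X : Matrix n p ℝ) (w : p → ℝ) :
    ∑ i, (X *ᵥ w) i = (Fintype.card n : ℝ) * (sampleMean X ⬝ᵥ w) := by
  simp only [Matrix.mulVec, dotProduct]
  rw [Finset.sum_comm, Finset.mul_sum]
  refine Finset.sum_congr rfl fun q _ => ?_
  rw [← Finset.sum_mul, sum_rows_apply, mul_assoc]

theorem sum_class_mulVec [Fintype n] [Fintype p] [DecidableEq κ]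
    (X : Matrix n p ℝ) (y : n → κ) (w : p → ℝ) (j : κ) :
    ∑ i with y i = j, (X *ᵥ w) i = classWeight y j * (classMean X y j ⬝ᵥ w) := by
  simp only [Matrix.mulVec, dotProduct]
  rw [Finset.sum_comm, Finset.mul_sum]
  refine Finset.sum_congr rfl fun q _ => ?_
  rw [← Finset.sum_mul, sum_class_apply, mul_assoc]

/-- The hat matrix is symmetric and may act on either factor. In this form the matrix sends scores
to class sums of fitted values. -/
theorem fitCross_eq [Fintype n] [Fintype p] [DecidableEq p] [DecidableEq κ]
    (X : Matrix n p ℝ) (lam : ℝ) (y : n → κ) :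
    fitCross X lam y =
      (indicatorMatrix y)ᵀ * (augment X * regWeights X lam (indicatorMatrix y)) := by
  simp only [fitCross, regWeights, Matrix.transpose_mul, regScatter_inv_transpose,
    Matrix.transpose_transpose, Matrix.mul_assoc]

/-! ### Regression on centred scores, with the bias eliminated -/

section Scoring

variable [Fintype n] [Fintype p] [DecidableEq p] [Fintype κ] [DecidableEq κ]

theorem regScatter_mulVec_inl (X : Matrix n p ℝ) (lam : ℝ) (β : p ⊕ Unit → ℝ) (q : p) :
    (regScatter X lam *ᵥ β) (Sum.inl q) =
      ∑ i, X i q * ((X *ᵥ (β ∘ Sum.inl)) i + β (Sum.inr ())) + lam * β (Sum.inl q) := by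
  rw [regScatter, Matrix.add_mulVec, ← Matrix.mulVec_mulVec, Matrix.smul_mulVec]
  simp only [Pi.add_apply, Pi.smul_apply, biasFreeId, Matrix.mulVec_diagonal, Sum.elim_inl,
    one_mul, smul_eq_mul]
  rw [Matrix.mulVec, dotProduct]
  simp only [augment_mulVec]
  rfl

theorem regScatter_mulVec_inr (X : Matrix n p ℝ) (lam : ℝ) (β : p ⊕ Unit → ℝ) :
    (regScatter X lam *ᵥ β) (Sum.inr ()) =
      ∑ i, ((X *ᵥ (β ∘ Sum.inl)) i + β (Sum.inr ())) := by
  rw [regScatter, Matrix.add_mulVec, ← Matrix.mulVec_mulVec, Matrix.smul_mulVec]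
  simp only [Pi.add_apply, Pi.smul_apply, biasFreeId, Matrix.mulVec_diagonal, Sum.elim_inr,
    zero_mul, smul_eq_mul, mul_zero, add_zero]
  rw [Matrix.mulVec, dotProduct]
  simp only [augment_mulVec]
  simp [augment]

/-- Only one factor needs centring, because the centred projections sum to zero; this matches the
feature rows of the normal equations. -/
theorem totalScatter_mulVec (X : Matrix n p ℝ) (y : n → κ) (w : p → ℝ) (q : p) :
    ((withinScatter X y + betweenScatter X y) *ᵥ w) q =
      ∑ i, X i q * ((X *ᵥ w) i - sampleMean X ⬝ᵥ w) := by
  have h0 : ∑ i, ((X *ᵥ w) i - sampleMean X ⬝ᵥ w) = 0 := by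
    rw [Finset.sum_sub_distrib, sum_mulVec]
    simp
  have h1 : ((withinScatter X y + betweenScatter X y) *ᵥ w) q =
      ∑ i, (X i q - sampleMean X q) * ((X *ᵥ w) i - sampleMean X ⬝ᵥ w) := by
    rw [Matrix.mulVec, dotProduct]
    simp only [within_add_betweenScatter_apply, Finset.sum_mul]
    rw [Finset.sum_comm]
    refine Finset.sum_congr rfl fun i _ => ?_
    simp only [Matrix.mulVec, dotProduct]
    rw [← Finset.sum_sub_distrib, Finset.mul_sum]
    exact Finset.sum_congr rfl fun r _ => by ring
  rw [h1]
  simp only [sub_mul, Finset.sum_sub_distrib]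
  rw [← Finset.mul_sum, Finset.sum_sub_distrib] at *
  rw [h0, mul_zero, sub_zero]

/-- For centred scores, the normal equations of the augmented problem are the normal equations of
the centred problem. -/
theorem normal_equations_iff [Nonempty n] (X : Matrix n p ℝ) (lam : ℝ) (y : n → κ) (θ : κ → ℝ)
    (hθ : ∑ j, classWeight y j * θ j = 0) (β : p ⊕ Unit → ℝ) :
    regScatter X lam *ᵥ β = (augment X)ᵀ *ᵥ (indicatorMatrix y *ᵥ θ) ↔
      β (Sum.inr ()) = -(sampleMean X ⬝ᵥ (β ∘ Sum.inl)) ∧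
      (withinScatter X y + lam • 1 + betweenScatter X y) *ᵥ (β ∘ Sum.inl) =
        (centredMeans X y)ᵀ *ᵥ (Matrix.diagonal (classWeight y) *ᵥ θ) := by
  have hN : (Fintype.card n : ℝ) ≠ 0 := by simp
  set w := β ∘ Sum.inl with hw
  have e1 : (regScatter X lam *ᵥ β) (Sum.inr ()) =
      (Fintype.card n : ℝ) * (sampleMean X ⬝ᵥ w + β (Sum.inr ())) := by
    rw [regScatter_mulVec_inr, ← hw, Finset.sum_add_distrib, sum_mulVec]
    simp [mul_add]
  have e2 : ((augment X)ᵀ *ᵥ (indicatorMatrix y *ᵥ θ)) (Sum.inr ()) = 0 := by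
    rw [indicatorMatrix_mulVec, ← hθ, ← sum_comp_label]
    simp [augment, Matrix.mulVec, dotProduct]
  have e3 : ∀ q, ((augment X)ᵀ *ᵥ (indicatorMatrix y *ᵥ θ)) (Sum.inl q) =
      ((centredMeans X y)ᵀ *ᵥ (Matrix.diagonal (classWeight y) *ᵥ θ)) q := by
    intro q
    have : ((augment X)ᵀ *ᵥ (indicatorMatrix y *ᵥ θ)) (Sum.inl q) = ∑ i, X i q * θ (y i) := by
      rw [indicatorMatrix_mulVec]; rfl
    rw [this, ← Finset.sum_fiberwise Finset.univ y]
    have h1 : ∀ j, ∑ i with y i = j, X i q * θ (y i) =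
        classWeight y j * classMean X y j q * θ j := by
      intro j
      rw [← sum_class_apply, Finset.sum_mul]
      refine Finset.sum_congr rfl fun i hi => ?_
      rw [(Finset.mem_filter.1 hi).2]
    have h2 : ((centredMeans X y)ᵀ *ᵥ (Matrix.diagonal (classWeight y) *ᵥ θ)) q =
        ∑ j, (classMean X y j q - sampleMean X q) * (classWeight y j * θ j) := by
      rw [Matrix.mulVec, dotProduct]
      simp only [Matrix.mulVec_diagonal]
      rfl
    -- Subtracting the overall mean times Σ n_j θ_j, which is zero, replaces class means by centred
    -- class means.
    rw [h2, ← sub_zero (∑ j, ∑ i with y i = j, X i q * θ (y i)), ← mul_zero (sampleMean X q), ← hθ,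
      Finset.mul_sum, ← Finset.sum_sub_distrib]
    refine Finset.sum_congr rfl fun j _ => ?_
    rw [h1]; ring
  have e4 : β (Sum.inr ()) = -(sampleMean X ⬝ᵥ w) → ∀ q, (regScatter X lam *ᵥ β) (Sum.inl q) =
      ((withinScatter X y + lam • 1 + betweenScatter X y) *ᵥ w) q := by
    intro hb q
    rw [regScatter_mulVec_inl, ← hw, hb, add_right_comm, Matrix.add_mulVec, Pi.add_apply,
      totalScatter_mulVec, Matrix.smul_mulVec, Matrix.one_mulVec]
    simp [hw, sub_eq_add_neg]
  constructor
  · intro h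
    have hb : β (Sum.inr ()) = -(sampleMean X ⬝ᵥ w) := by
      have := congrFun h (Sum.inr ())
      rw [e1, e2] at this
      have := (mul_eq_zero.1 this).resolve_left hN
      linarith
    refine ⟨hb, ?_⟩
    ext q
    rw [← e4 hb, h, e3]
  · rintro ⟨hb, h⟩
    ext (q | q)
    · rw [e4 hb, h, e3]
    · rw [e1, e2, hb, add_neg_cancel, mul_zero]

theorem indicatorMatrix_transpose_augment_mulVec (X : Matrix n p ℝ) (y : n → κ)
    (β : p ⊕ Unit → ℝ) (hb : β (Sum.inr ()) = -(sampleMean X ⬝ᵥ (β ∘ Sum.inl))) :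
    (indicatorMatrix y)ᵀ *ᵥ (augment X *ᵥ β) =
      Matrix.diagonal (classWeight y) *ᵥ (centredMeans X y *ᵥ (β ∘ Sum.inl)) := by
  ext j
  rw [indicatorMatrix_transpose_mulVec, Matrix.mulVec_diagonal]
  simp only [augment_mulVec]
  rw [Finset.sum_add_distrib, sum_class_mulVec, sum_class_const, hb, ← mul_add]
  congr 1
  rw [← sub_eq_add_neg, ← sub_dotProduct]
  rfl

theorem fitCross_isSymm (X : Matrix n p ℝ) (lam : ℝ) (y : n → κ) :
    (fitCross X lam y)ᵀ = fitCross X lam y := by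
  rw [fitCross_eq X lam y, Matrix.transpose_mul, Matrix.transpose_transpose, ← fitCross_eq X lam y]
  rfl

theorem fitCross_mulVec (X : Matrix n p ℝ) (lam : ℝ) (y : n → κ) (θ : κ → ℝ) :
    fitCross X lam y *ᵥ θ = (indicatorMatrix y)ᵀ *ᵥ
      (augment X *ᵥ (regWeights X lam (indicatorMatrix y) *ᵥ θ)) := by
  rw [fitCross_eq, Matrix.mulVec_mulVec, Matrix.mulVec_mulVec, Matrix.mul_assoc]

/-- Constant scores are reproduced without error by the bias alone, which carries no penalty. -/
theorem regWeights_mulVec_one (X : Matrix n p ℝ) {lam : ℝ}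
    (h : IsUnit (regScatter X lam).det) (y : n → κ) :
    regWeights X lam (indicatorMatrix y) *ᵥ (fun _ => 1) =
      Sum.elim (0 : p → ℝ) (1 : Unit → ℝ) := by
  refine regWeights_mulVec_eq X h _ _ _ ?_
  rw [indicatorMatrix_mulVec]
  ext (q | q)
  · rw [regScatter_mulVec_inl]
    simp [augment, Matrix.mulVec, dotProduct]
  · rw [regScatter_mulVec_inr]
    simp [augment, Matrix.mulVec, dotProduct]

theorem fitCross_mulVec_one (X : Matrix n p ℝ) {lam : ℝ}
    (h : IsUnit (regScatter X lam).det) (y : n → κ) :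
    fitCross X lam y *ᵥ (fun _ => 1) = classWeight y := by
  rw [fitCross_mulVec, regWeights_mulVec_one X h]
  ext j
  rw [indicatorMatrix_transpose_mulVec]
  simp only [augment_mulVec]
  simp [Matrix.mulVec, dotProduct, classWeight, classCount]

section Centred

variable [Nonempty n]

theorem regWeights_centred (X : Matrix n p ℝ) {lam : ℝ}
    (h : IsUnit (regScatter X lam).det) (y : n → κ) {θ : κ → ℝ}
    (hθ : ∑ j, classWeight y j * θ j = 0) :
    (regWeights X lam (indicatorMatrix y) *ᵥ θ) (Sum.inr ()) =
        -(sampleMean X ⬝ᵥ (dropBias (regWeights X lam (indicatorMatrix y)) *ᵥ θ)) ∧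
      (withinScatter X y + lam • 1 + betweenScatter X y) *ᵥ
          (dropBias (regWeights X lam (indicatorMatrix y)) *ᵥ θ) =
        (centredMeans X y)ᵀ *ᵥ (Matrix.diagonal (classWeight y) *ᵥ θ) := by
  refine (normal_equations_iff X lam y θ hθ _).1 ?_
  rw [Matrix.mulVec_mulVec, regScatter_mul_regWeights X h, Matrix.mulVec_mulVec]

theorem fitCross_mulVec_centred (X : Matrix n p ℝ) {lam : ℝ}
    (h : IsUnit (regScatter X lam).det) (y : n → κ) {θ : κ → ℝ}
    (hθ : ∑ j, classWeight y j * θ j = 0) :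
    fitCross X lam y *ᵥ θ = Matrix.diagonal (classWeight y) *ᵥ
      (centredMeans X y *ᵥ (dropBias (regWeights X lam (indicatorMatrix y)) *ᵥ θ)) := by
  rw [fitCross_mulVec, indicatorMatrix_transpose_augment_mulVec X y _
    (regWeights_centred X h y hθ).1]
  rfl

theorem dropBias_regWeights_mulVec_eq (X : Matrix n p ℝ) {lam : ℝ}
    (h : IsUnit (regScatter X lam).det) (y : n → κ) {θ : κ → ℝ}
    (hθ : ∑ j, classWeight y j * θ j = 0)
    (w : p → ℝ) (hw : (withinScatter X y + lam • 1 + betweenScatter X y) *ᵥ w =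
      (centredMeans X y)ᵀ *ᵥ (Matrix.diagonal (classWeight y) *ᵥ θ)) :
    dropBias (regWeights X lam (indicatorMatrix y)) *ᵥ θ = w := by
  have h1 := regWeights_mulVec_eq X h (indicatorMatrix y) θ
    (Sum.elim w fun _ => -(sampleMean X ⬝ᵥ w))
    ((normal_equations_iff X lam y θ hθ _).2 ⟨rfl, hw⟩)
  ext q
  exact congrFun h1 (Sum.inl q)

end Centred

end Scoring

theorem dotProduct_diagonal_mulVec [Fintype κ] [DecidableEq κ] (m u v : κ → ℝ) :
    u ⬝ᵥ (Matrix.diagonal m *ᵥ v) = ∑ j, m j * u j * v j := by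
  simp only [dotProduct, Matrix.mulVec_diagonal]
  exact Finset.sum_congr rfl fun j _ => by ring

theorem diagonal_mulVec_injective [Fintype κ] [DecidableEq κ] {m : κ → ℝ} (hm : ∀ j, m j ≠ 0)
    {u v : κ → ℝ} (h : Matrix.diagonal m *ᵥ u = Matrix.diagonal m *ᵥ v) : u = v := by
  ext j
  have := congrFun h j
  rw [Matrix.mulVec_diagonal, Matrix.mulVec_diagonal] at this
  exact mul_left_cancel₀ (hm j) this

theorem betweenScatter_mulVec [Fintype n] [Fintype p] [Fintype κ] [DecidableEq κ]
    (X : Matrix n p ℝ) (y : n → κ) (w : p → ℝ) :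
    betweenScatter X y *ᵥ w = (centredMeans X y)ᵀ *ᵥ
      (Matrix.diagonal (classWeight y) *ᵥ (centredMeans X y *ᵥ w)) := by
  rw [betweenScatter_eq, Matrix.mulVec_mulVec, Matrix.mulVec_mulVec, Matrix.mul_assoc]

theorem dotProduct_betweenScatter_mulVec [Fintype n] [Fintype p] [Fintype κ] [DecidableEq κ]
    (X : Matrix n p ℝ) (y : n → κ) (w w' : p → ℝ) :
    w ⬝ᵥ (betweenScatter X y *ᵥ w') = (centredMeans X y *ᵥ w) ⬝ᵥ
      (Matrix.diagonal (classWeight y) *ᵥ (centredMeans X y *ᵥ w')) := by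
  rw [betweenScatter_mulVec, Matrix.dotProduct_mulVec, Matrix.vecMul_transpose]

theorem centredMeans_mulVec_centred [Fintype n] [Fintype p] [Fintype κ] [DecidableEq κ]
    (X : Matrix n p ℝ) (y : n → κ) (w : p → ℝ) :
    ∑ j, classWeight y j * (centredMeans X y *ᵥ w) j = 0 := by
  simp only [Matrix.mulVec, dotProduct, Finset.mul_sum]
  rw [Finset.sum_comm]
  refine Finset.sum_eq_zero fun q _ => ?_
  simp only [← mul_assoc]
  rw [← Finset.sum_mul, sum_classWeight_mul_centredMeans, zero_mul]

/-- If the between-classes scatter matrix has maximal rank, then only the constant scores are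
annihilated by the transposed matrix of centred class means. -/
theorem eq_zero_of_centredMeans_transpose_mulVec [Fintype n] [Fintype p] [Fintype κ]
    [DecidableEq κ] (X : Matrix n p ℝ) {y : n → κ} (hy : ∀ j, 0 < classWeight y j)
    (hr : Fintype.card κ ≤ (betweenScatter X y).rank + 1) {θ : κ → ℝ}
    (hθ : ∑ j, classWeight y j * θ j = 0)
    (h : (centredMeans X y)ᵀ *ᵥ (Matrix.diagonal (classWeight y) *ᵥ θ) = 0) : θ = 0 := by
  by_contra hne
  obtain ⟨j₁, hj₁⟩ : ∃ j, θ j ≠ 0 := by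
    by_contra! h0
    exact hne (funext h0)
  have hrank : (betweenScatter X y).rank ≤ ((centredMeans X y)ᵀ).rank := by
    rw [betweenScatter_eq, Matrix.mul_assoc]
    exact Matrix.rank_mul_le_left _ _
  have hker := LinearMap.finrank_range_add_finrank_ker ((centredMeans X y)ᵀ).mulVecLin
  rw [Module.finrank_fintype_fun_eq_card] at hker
  have hone : (centredMeans X y)ᵀ *ᵥ classWeight y = 0 := by
    ext q
    rw [Matrix.mulVec, dotProduct]
    simpa [mul_comm] using sum_classWeight_mul_centredMeans X y q
  -- The class sizes M1 and the vector Mθ both lie in the kernel of Cᵀ. For centred θ ≠ 0 they are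
  -- independent, so the nullity is at least 2 and the rank of Cᵀ, hence that of S_b, falls below
  -- the assumed bound.
  let u : LinearMap.ker ((centredMeans X y)ᵀ).mulVecLin :=
    ⟨classWeight y, by rw [LinearMap.mem_ker, Matrix.mulVecLin_apply]; exact hone⟩
  let v : LinearMap.ker ((centredMeans X y)ᵀ).mulVecLin :=
    ⟨Matrix.diagonal (classWeight y) *ᵥ θ, by
      rw [LinearMap.mem_ker, Matrix.mulVecLin_apply]; exact h⟩
  have hli : LinearIndependent ℝ ![u, v] := by
    rw [LinearIndependent.pair_iff]
    intro s t hst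
    have h1 : ∀ j, s + t * θ j = 0 := by
      intro j
      have h2 := congrFun (congrArg Subtype.val hst) j
      have h3 : s * classWeight y j + t * (classWeight y j * θ j) = 0 := by
        simpa [u, v, Matrix.mulVec_diagonal] using h2
      have h4 : classWeight y j * (s + t * θ j) = 0 := by linear_combination h3
      exact (mul_eq_zero.1 h4).resolve_left (hy j).ne'
    have hW : 0 < ∑ j, classWeight y j :=
      Finset.sum_pos (fun j _ => hy j) ⟨j₁, Finset.mem_univ _⟩
    have hs : s = 0 := by
      have h2 : ∑ j, classWeight y j * (s + t * θ j) = 0 :=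
        Finset.sum_eq_zero fun j _ => by rw [h1, mul_zero]
      have h3 : ∑ j, classWeight y j * (s + t * θ j) =
          (∑ j, classWeight y j) * s + t * ∑ j, classWeight y j * θ j := by
        rw [Finset.sum_mul, Finset.mul_sum, ← Finset.sum_add_distrib]
        exact Finset.sum_congr rfl fun j _ => by ring
      rw [h3, hθ, mul_zero, add_zero] at h2
      exact (mul_eq_zero.1 h2).resolve_left hW.ne'
    refine ⟨hs, ?_⟩
    have := h1 j₁
    rw [hs, zero_add] at this
    exact (mul_eq_zero.1 this).resolve_right hj₁
  have h2 := hli.fintype_card_le_finrank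
  rw [Fintype.card_fin] at h2
  have h3 : ((centredMeans X y)ᵀ).rank =
    Module.finrank ℝ (LinearMap.range ((centredMeans X y)ᵀ).mulVecLin) := rfl
  omega

/-! ### From eigenvectors of scores to the generalised eigenproblem of LDA -/

section Scoring

variable [Fintype n] [Fintype p] [DecidableEq p] [Fintype κ] [DecidableEq κ]

section Eigen

variable [Nonempty n]

theorem centredMeans_mulVec_of_eigen (X : Matrix n p ℝ) {lam : ℝ}
    (h : IsUnit (regScatter X lam).det) {y : n → κ} (hy : ∀ j, 0 < classWeight y j)
    {θ : κ → ℝ} {a : ℝ} (hθ : ∑ j, classWeight y j * θ j = 0)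
    (he : fitCross X lam y *ᵥ θ = a • (Matrix.diagonal (classWeight y) *ᵥ θ)) :
    centredMeans X y *ᵥ (dropBias (regWeights X lam (indicatorMatrix y)) *ᵥ θ) = a • θ := by
  rw [fitCross_mulVec_centred X h y hθ, ← Matrix.mulVec_smul] at he
  exact diagonal_mulVec_injective (fun j => (hy j).ne') he

/-- Since Cw = aθ, one has S_b w = CᵀMCw = a CᵀMθ = a(S_w + S_b) w; the rest is rearrangement. -/
theorem betweenScatter_mulVec_of_eigen (X : Matrix n p ℝ) {lam : ℝ}
    (h : IsUnit (regScatter X lam).det) {y : n → κ} (hy : ∀ j, 0 < classWeight y j)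
    {θ : κ → ℝ} {a : ℝ} (hθ : ∑ j, classWeight y j * θ j = 0)
    (he : fitCross X lam y *ᵥ θ = a • (Matrix.diagonal (classWeight y) *ᵥ θ)) :
    (1 - a) • (betweenScatter X y *ᵥ
        (dropBias (regWeights X lam (indicatorMatrix y)) *ᵥ θ)) =
      a • ((withinScatter X y + lam • 1) *ᵥ
        (dropBias (regWeights X lam (indicatorMatrix y)) *ᵥ θ)) := by
  have h1 := (regWeights_centred X h y hθ).2
  rw [Matrix.add_mulVec] at h1
  have h2 : betweenScatter X y *ᵥ (dropBias (regWeights X lam (indicatorMatrix y)) *ᵥ θ) =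
      a • ((centredMeans X y)ᵀ *ᵥ (Matrix.diagonal (classWeight y) *ᵥ θ)) := by
    rw [betweenScatter_mulVec, centredMeans_mulVec_of_eigen X h hy hθ he, Matrix.mulVec_smul,
      Matrix.mulVec_smul]
  rw [← h1, smul_add] at h2
  rw [sub_smul, one_smul, sub_eq_iff_eq_add]
  exact h2

theorem dotProduct_withinScatter_of_eigen (X : Matrix n p ℝ) {lam : ℝ}
    (h : IsUnit (regScatter X lam).det) {y : n → κ} (hy : ∀ j, 0 < classWeight y j)
    {θ θ' : κ → ℝ} {a a' : ℝ} (hθ : ∑ j, classWeight y j * θ j = 0)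
    (he : fitCross X lam y *ᵥ θ = a • (Matrix.diagonal (classWeight y) *ᵥ θ))
    (hθ' : ∑ j, classWeight y j * θ' j = 0)
    (he' : fitCross X lam y *ᵥ θ' = a' • (Matrix.diagonal (classWeight y) *ᵥ θ')) :
    (dropBias (regWeights X lam (indicatorMatrix y)) *ᵥ θ) ⬝ᵥ
        ((withinScatter X y + lam • 1) *ᵥ
          (dropBias (regWeights X lam (indicatorMatrix y)) *ᵥ θ')) =
      a * (1 - a') * (θ ⬝ᵥ (Matrix.diagonal (classWeight y) *ᵥ θ')) := by
  have h1 := (regWeights_centred X h y hθ').2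
  rw [Matrix.add_mulVec, ← eq_sub_iff_add_eq] at h1
  rw [h1, dotProduct_sub, dotProduct_betweenScatter_mulVec, Matrix.dotProduct_mulVec,
    Matrix.vecMul_transpose, centredMeans_mulVec_of_eigen X h hy hθ he,
    centredMeans_mulVec_of_eigen X h hy hθ' he', Matrix.mulVec_smul, smul_dotProduct,
    smul_dotProduct, dotProduct_smul]
  simp only [smul_eq_mul]
  ring

/-- The rank bound excludes w = 0, so 0 < wᵀ S_w w = a(1 − a) θᵀMθ, and θᵀMθ ≥ 0 forces a(1 − a) >
0. -/
theorem eigenvalue_mem_Ioo (X : Matrix n p ℝ) {lam : ℝ}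
    (h : IsUnit (regScatter X lam).det) {y : n → κ} (hy : ∀ j, 0 < classWeight y j)
    (hS : (withinScatter X y + lam • 1).PosDef)
    (hr : Fintype.card κ ≤ (betweenScatter X y).rank + 1)
    {θ : κ → ℝ} {a : ℝ} (hne : θ ≠ 0) (hθ : ∑ j, classWeight y j * θ j = 0)
    (he : fitCross X lam y *ᵥ θ = a • (Matrix.diagonal (classWeight y) *ᵥ θ)) :
    0 < a ∧ a < 1 := by
  set w := dropBias (regWeights X lam (indicatorMatrix y)) *ᵥ θ with hw
  have hw0 : w ≠ 0 := by
    intro h0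
    refine hne (eq_zero_of_centredMeans_transpose_mulVec X hy hr hθ ?_)
    rw [← (regWeights_centred X h y hθ).2, ← hw, h0, Matrix.mulVec_zero]
  have h1 := hS.dotProduct_mulVec_pos hw0
  rw [star_trivial, dotProduct_withinScatter_of_eigen X h hy hθ he hθ he,
    dotProduct_diagonal_mulVec] at h1
  have h2 : 0 ≤ ∑ j, classWeight y j * θ j * θ j := Finset.sum_nonneg fun j _ => by
    rw [mul_assoc]; exact mul_nonneg (hy j).le (mul_self_nonneg _)
  have h3 : 0 < a * (1 - a) := by
    by_contra! h4
    exact absurd h1 (not_lt.2 (mul_nonpos_of_nonpos_of_nonneg h4 h2))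
  constructor <;> nlinarith [sq_nonneg a, sq_nonneg (1 - a)]

theorem isEigenAnalysis_iff (X : Matrix n p ℝ) (lam : ℝ) (y : n → κ) (Θ : Matrix κ κ ℝ)
    (a : κ → ℝ) :
    IsEigenAnalysis (augment X * regWeights X lam (indicatorMatrix y)) (indicatorMatrix y) Θ a ↔
      (∀ k, fitCross X lam y *ᵥ Θ.col k =
        a k • (Matrix.diagonal (classWeight y) *ᵥ Θ.col k)) ∧
      ∀ k l, Θ.col k ⬝ᵥ (Matrix.diagonal (classWeight y) *ᵥ Θ.col l) =
        if k = l then (Fintype.card n : ℝ) else 0 := by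
  have hN : (Fintype.card n : ℝ) ≠ 0 := by simp
  have e1 : ((Fintype.card n : ℝ)⁻¹ •
        ((augment X * regWeights X lam (indicatorMatrix y))ᵀ * indicatorMatrix y)) * Θ =
      ((Fintype.card n : ℝ)⁻¹ • ((indicatorMatrix y)ᵀ * indicatorMatrix y)) * Θ *
        Matrix.diagonal a ↔ ∀ k, fitCross X lam y *ᵥ Θ.col k =
        a k • (Matrix.diagonal (classWeight y) *ᵥ Θ.col k) := by
    rw [indicatorMatrix_transpose_mul_self, Matrix.smul_mul, Matrix.smul_mul, Matrix.smul_mul,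
      (smul_right_injective _ (inv_ne_zero hN)).eq_iff]
    constructor
    · intro h k
      ext j
      have := congrFun (congrFun h j) k
      rw [Matrix.mul_diagonal, mul_comm] at this
      exact this
    · intro h
      ext j k
      rw [Matrix.mul_diagonal, mul_comm]
      exact congrFun (h k) j
  have e2 : Θᵀ * ((Fintype.card n : ℝ)⁻¹ • ((indicatorMatrix y)ᵀ * indicatorMatrix y)) * Θ = 1 ↔
      ∀ k l, Θ.col k ⬝ᵥ (Matrix.diagonal (classWeight y) *ᵥ Θ.col l) =
        if k = l then (Fintype.card n : ℝ) else 0 := by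
    rw [indicatorMatrix_transpose_mul_self, Matrix.mul_smul, Matrix.smul_mul, Matrix.mul_assoc,
      inv_smul_eq_iff₀ hN]
    constructor
    · intro h k l
      have := congrFun (congrFun h k) l
      rw [Matrix.smul_apply, Matrix.one_apply, smul_eq_mul, mul_ite, mul_one, mul_zero] at this
      exact this
    · intro h
      ext k l
      rw [Matrix.smul_apply, Matrix.one_apply, smul_eq_mul, mul_ite, mul_one, mul_zero]
      exact h k l
  exact ⟨fun h => ⟨e1.1 h.eigen, e2.1 h.orthonormal⟩, fun h => ⟨e1.2 h.1, e2.2 h.2⟩⟩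

/-- The substitution θ = M^(−1/2) u turns the problem into the spectral theorem for the symmetric
matrix M^(−1/2) K M^(−1/2). -/
theorem exists_isEigenAnalysis (X : Matrix n p ℝ) (lam : ℝ) {y : n → κ}
    (hy : ∀ j, 0 < classWeight y j) :
    ∃ Θ a, IsEigenAnalysis (augment X * regWeights X lam (indicatorMatrix y))
      (indicatorMatrix y) Θ a := by
  have hN : (0 : ℝ) < Fintype.card n := by simp [Fintype.card_pos]
  set K := fitCross X lam y with hK
  set r : κ → ℝ := fun j => Real.sqrt (classWeight y j) with hr
  have hr0 : ∀ j, r j ≠ 0 := fun j => (Real.sqrt_pos.2 (hy j)).ne'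
  have hrr : ∀ j, r j * r j = classWeight y j := fun j => Real.mul_self_sqrt (hy j).le
  set R : Matrix κ κ ℝ := Matrix.diagonal r with hR
  set R' : Matrix κ κ ℝ := Matrix.diagonal fun j => (r j)⁻¹ with hR'
  have hRR' : R * R' = 1 := by
    rw [hR, hR', Matrix.diagonal_mul_diagonal, ← Matrix.diagonal_one]
    exact congrArg _ (funext fun j => mul_inv_cancel₀ (hr0 j))
  have hM : Matrix.diagonal (classWeight y) = R * R := by
    rw [hR, Matrix.diagonal_mul_diagonal]
    exact congrArg _ (funext fun j => (hrr j).symm)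
  have hR't : R'ᵀ = R' := Matrix.diagonal_transpose _
  have hH : (R' * K * R').IsHermitian := by
    rw [Matrix.IsHermitian, Matrix.conjTranspose_eq_transpose_of_trivial, Matrix.transpose_mul,
      Matrix.transpose_mul, hR't, hK, fitCross_isSymm, Matrix.mul_assoc]
  set U : Matrix κ κ ℝ := hH.eigenvectorUnitary.1 with hU
  have hUU : Uᵀ * U = 1 := by
    have := Matrix.mem_unitaryGroup_iff'.1 hH.eigenvectorUnitary.2
    simpa [hU, Matrix.star_eq_conjTranspose] using this
  have hSU : R' * K * R' * U = U * Matrix.diagonal hH.eigenvalues := by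
    ext j k
    have := congrFun (hH.mulVec_eigenvectorBasis k) j
    rw [Matrix.mul_diagonal, mul_comm]
    exact this
  -- The factor √N compensates the N⁻¹ in the normalisation.
  refine ⟨Real.sqrt (Fintype.card n) • (R' * U), hH.eigenvalues, ?_, ?_⟩
  · rw [indicatorMatrix_transpose_mul_self, hM]
    change (_ • K) * _ = _
    have h1 : K * (R' * U) = R * R * (R' * U) * Matrix.diagonal hH.eigenvalues := by
      have e1 : R * R * (R' * U) = R * U := by
        rw [Matrix.mul_assoc, ← Matrix.mul_assoc R R' U, hRR', Matrix.one_mul]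
      have e2 : R * (R' * K * R' * U) = K * (R' * U) := by
        simp only [← Matrix.mul_assoc, hRR', Matrix.one_mul]
      rw [e1, ← e2, hSU]
      exact (Matrix.mul_assoc _ _ _).symm
    simp only [Matrix.smul_mul, Matrix.mul_smul, h1]
  · rw [indicatorMatrix_transpose_mul_self, hM]
    have h1 : (R' * U)ᵀ * (R * R) * (R' * U) = 1 := by
      have hR'R : R' * R = 1 := mul_eq_one_comm.1 hRR'
      have e1 : Uᵀ * R' * (R * R) * (R' * U) = Uᵀ * (R' * R) * (R * R') * U := by
        simp only [Matrix.mul_assoc]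
      rw [Matrix.transpose_mul, hR't, e1, hRR', hR'R, Matrix.mul_one, Matrix.mul_one, hUU]
    simp only [Matrix.transpose_smul, Matrix.smul_mul, Matrix.mul_smul, h1, smul_smul]
    rw [← mul_assoc, mul_comm, ← mul_assoc]
    field_simp
    rw [Real.sq_sqrt hN.le]
    simp [hN.ne']

end Eigen

end Scoring

/-! ### Columnwise forms and shifts of scores -/

theorem isDiscriminantCoordinates_iff [Fintype p] [Fintype d] [DecidableEq d]
    (Sb Sw : Matrix p p ℝ) (W : Matrix p d ℝ) :
    IsDiscriminantCoordinates Sb Sw W ↔ ∃ Λ : d → ℝ, (∀ k, Λ k ≠ 0) ∧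
      (∀ k, Sb *ᵥ W.col k = Λ k • (Sw *ᵥ W.col k)) ∧
      ∀ k l, W.col k ⬝ᵥ (Sw *ᵥ W.col l) = if k = l then 1 else 0 := by
  refine exists_congr fun Λ => and_congr Iff.rfl (and_congr ?_ ?_)
  · constructor
    · intro h k
      ext j
      have := congrFun (congrFun h j) k
      rw [Matrix.mul_diagonal, mul_comm] at this
      exact this
    · intro h
      ext j k
      rw [Matrix.mul_diagonal, mul_comm]
      exact congrFun (h k) j
  · rw [Matrix.mul_assoc]
    constructor
    · intro h k l
      have := congrFun (congrFun h k) l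
      rw [Matrix.one_apply] at this
      exact this
    · intro h
      ext k l
      rw [Matrix.one_apply]
      exact h k l

/-- The matrix inverse of a diagonal matrix is entrywise only when no diagonal entry vanishes; the
bounds on the eigenvalues secure this. -/
theorem scaledScores_col {c : ℕ} (N : ℕ) (Θ : Matrix (Fin (c + 1)) (Fin (c + 1)) ℝ)
    (a : Fin (c + 1) → ℝ) (j₀ : Fin (c + 1))
    (ha : ∀ k, k ≠ j₀ → 0 < a k ∧ a k < 1) (k : Fin c) :
    (scaledScores N Θ a j₀).col k =
      (Real.sqrt N * Real.sqrt (a (j₀.succAbove k) * (1 - a (j₀.succAbove k))))⁻¹ •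
        Θ.col (j₀.succAbove k) := by
  have h0 : ∀ k : Fin c, Real.sqrt (a (j₀.succAbove k) * (1 - a (j₀.succAbove k))) ≠ 0 := by
    intro k
    obtain ⟨h1, h2⟩ := ha _ (Fin.succAbove_ne j₀ k)
    exact (Real.sqrt_pos.2 (mul_pos h1 (by linarith))).ne'
  have h1 : (Matrix.diagonal fun k : Fin c =>
      Real.sqrt (a (j₀.succAbove k) * (1 - a (j₀.succAbove k))))⁻¹ =
      Matrix.diagonal fun k : Fin c =>
        (Real.sqrt (a (j₀.succAbove k) * (1 - a (j₀.succAbove k))))⁻¹ := by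
    refine Matrix.inv_eq_left_inv ?_
    rw [Matrix.diagonal_mul_diagonal, ← Matrix.diagonal_one]
    exact congrArg _ (funext fun k => inv_mul_cancel₀ (h0 k))
  ext j
  rw [Matrix.col_apply, scaledScores, scalingMatrix, h1, Matrix.mul_smul, Matrix.smul_apply,
    Matrix.mul_diagonal, mul_inv]
  simp only [dropCol, Matrix.submatrix_apply, id, smul_eq_mul, Pi.smul_apply, Matrix.col_apply]
  ring

theorem mul_col [Fintype κ] (A : Matrix p κ ℝ) (B : Matrix κ d ℝ) (k : d) :
    (A * B).col k = A *ᵥ B.col k := rfl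

theorem augment_mul_mul_row [Fintype p] [Fintype κ] (X : Matrix n p ℝ)
    (B : Matrix (p ⊕ Unit) κ ℝ) (S : Matrix κ d ℝ) (i : n) :
    (augment X * B * S) i = (X * (dropBias B * S)) i + (B * S) (Sum.inr ()) := by
  ext k
  rw [Matrix.mul_assoc, augment_mul, Pi.add_apply]
  rfl

theorem classMean_add_const [Fintype n] [DecidableEq κ] (A A' : Matrix n d ℝ) {y : n → κ}
    (b : d → ℝ) (hA : ∀ i, A i = A' i + b) {j : κ} (hy : 0 < classWeight y j) :
    classMean A y j = classMean A' y j + b := by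
  ext k
  have h1 := sum_class_apply A y j k
  have h2 := sum_class_apply A' y j k
  have h3 := sum_class_const y j (b k)
  have h4 : ∑ i with y i = j, A i k = ∑ i with y i = j, A' i k + ∑ i with y i = j, b k := by
    rw [← Finset.sum_add_distrib]
    exact Finset.sum_congr rfl fun i _ => by rw [hA]; rfl
  rw [h1, h2, h3, ← mul_add] at h4
  exact mul_left_cancel₀ hy.ne' h4

/-! ### Optimality of the scores and the trivial eigenvalue -/

section Scoring

variable [Fintype n] [Nonempty n] [Fintype p] [DecidableEq p] [Fintype κ] [DecidableEq κ]

theorem sum_indicatorMatrix_mulVec_sq (y : n → κ) (θ : κ → ℝ) :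
    ∑ i, (indicatorMatrix y *ᵥ θ) i ^ 2 = θ ⬝ᵥ (Matrix.diagonal (classWeight y) *ᵥ θ) := by
  rw [indicatorMatrix_mulVec, dotProduct_diagonal_mulVec, sum_comp_label y fun j => θ j ^ 2]
  exact Finset.sum_congr rfl fun j _ => by ring

theorem indicatorMatrix_mulVec_dotProduct (y : n → κ) (θ θ' : κ → ℝ) :
    (indicatorMatrix y *ᵥ θ) ⬝ᵥ (indicatorMatrix y *ᵥ θ') =
      θ ⬝ᵥ (Matrix.diagonal (classWeight y) *ᵥ θ') := by
  rw [← indicatorMatrix_transpose_mul_self, ← Matrix.mulVec_mulVec, Matrix.dotProduct_mulVec θ,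
    Matrix.vecMul_transpose]

theorem dotProduct_fitCross_comm (X : Matrix n p ℝ) (lam : ℝ) (y : n → κ) (θ θ' : κ → ℝ) :
    θ ⬝ᵥ (fitCross X lam y *ᵥ θ') = θ' ⬝ᵥ (fitCross X lam y *ᵥ θ) := by
  rw [Matrix.dotProduct_mulVec, ← Matrix.mulVec_transpose, fitCross_isSymm, dotProduct_comm]

variable {X : Matrix n p ℝ} {lam : ℝ} {y : n → κ} {Θ : Matrix κ κ ℝ} {a : κ → ℝ}

/-- Eigenvectors of different eigenvalues are M-orthogonal, and the constant vector has eigenvalue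
1. -/
theorem IsEigenAnalysis.centred_of_ne_one
    (hE : IsEigenAnalysis (augment X * regWeights X lam (indicatorMatrix y))
      (indicatorMatrix y) Θ a) (h : IsUnit (regScatter X lam).det) {k : κ} (hk : a k ≠ 1) :
    ∑ j, classWeight y j * Θ.col k j = 0 := by
  have he := ((isEigenAnalysis_iff X lam y Θ a).1 hE).1 k
  have h1 := dotProduct_fitCross_comm X lam y (fun _ => 1) (Θ.col k)
  rw [fitCross_mulVec_one X h, he, dotProduct_smul, dotProduct_diagonal_mulVec] at h1
  have h2 : Θ.col k ⬝ᵥ classWeight y = ∑ j, classWeight y j * Θ.col k j :=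
    Finset.sum_congr rfl fun j _ => mul_comm _ _
  simp only [mul_one, h2, smul_eq_mul] at h1
  have h3 : (a k - 1) * ∑ j, classWeight y j * Θ.col k j = 0 := by linear_combination h1
  exact (mul_eq_zero.1 h3).resolve_left (sub_ne_zero.2 hk)

/-- For square matrices a left inverse is a right inverse, so orthonormal columns already form a
basis with these coordinates. -/
theorem IsEigenAnalysis.mulVec_expansion
    (hE : IsEigenAnalysis (augment X * regWeights X lam (indicatorMatrix y))
      (indicatorMatrix y) Θ a) (θ : κ → ℝ) :
    θ = Θ *ᵥ fun l => (Fintype.card n : ℝ)⁻¹ *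
      (Θ.col l ⬝ᵥ (Matrix.diagonal (classWeight y) *ᵥ θ)) := by
  have h1 := mul_eq_one_comm.1 hE.orthonormal
  have h2 : (fun l => (Fintype.card n : ℝ)⁻¹ *
      (Θ.col l ⬝ᵥ (Matrix.diagonal (classWeight y) *ᵥ θ))) =
      (Θᵀ * ((Fintype.card n : ℝ)⁻¹ • ((indicatorMatrix y)ᵀ * indicatorMatrix y))) *ᵥ θ := by
    rw [indicatorMatrix_transpose_mul_self, Matrix.mul_smul, Matrix.smul_mulVec,
      ← Matrix.mulVec_mulVec]
    rfl
  rw [h2, Matrix.mulVec_mulVec, h1, Matrix.one_mulVec]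

theorem mulVec_eq_sum_col (Θ : Matrix κ κ ℝ) (x : κ → ℝ) : Θ *ᵥ x = ∑ l, x l • Θ.col l := by
  ext j
  simp only [Matrix.mulVec, dotProduct, Finset.sum_apply, Pi.smul_apply, smul_eq_mul,
    Matrix.col_apply]
  exact Finset.sum_congr rfl fun l _ => mul_comm _ _

theorem IsEigenAnalysis.dotProduct_expansion
    (hE : IsEigenAnalysis (augment X * regWeights X lam (indicatorMatrix y))
      (indicatorMatrix y) Θ a) (x : κ → ℝ) :
    (Θ *ᵥ x) ⬝ᵥ (Matrix.diagonal (classWeight y) *ᵥ (Θ *ᵥ x)) =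
        (Fintype.card n : ℝ) * ∑ l, x l ^ 2 ∧
      (Θ *ᵥ x) ⬝ᵥ (fitCross X lam y *ᵥ (Θ *ᵥ x)) =
        (Fintype.card n : ℝ) * ∑ l, a l * x l ^ 2 := by
  obtain ⟨he, ho⟩ := (isEigenAnalysis_iff X lam y Θ a).1 hE
  have key : ∀ z : κ → ℝ, (Θ *ᵥ x) ⬝ᵥ
      ∑ l, z l • (Matrix.diagonal (classWeight y) *ᵥ Θ.col l) =
      (Fintype.card n : ℝ) * ∑ l, x l * z l := by
    intro z
    rw [mulVec_eq_sum_col, sum_dotProduct, Finset.mul_sum]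
    refine Finset.sum_congr rfl fun k _ => ?_
    rw [dotProduct_sum, Finset.sum_eq_single k]
    · rw [smul_dotProduct, dotProduct_smul, ho, if_pos rfl, smul_eq_mul, smul_eq_mul]
      ring
    · intro l _ hl
      rw [smul_dotProduct, dotProduct_smul, ho, if_neg hl.symm, smul_zero, smul_zero]
    · simp
  constructor
  · have h1 : Matrix.diagonal (classWeight y) *ᵥ (Θ *ᵥ x) =
        ∑ l, x l • (Matrix.diagonal (classWeight y) *ᵥ Θ.col l) := by
      rw [mulVec_eq_sum_col Θ, Matrix.mulVec_sum]
      exact Finset.sum_congr rfl fun l _ => Matrix.mulVec_smul _ _ _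
    rw [h1, key]
    simp only [sq]
  · have h1 : fitCross X lam y *ᵥ (Θ *ᵥ x) =
        ∑ l, (a l * x l) • (Matrix.diagonal (classWeight y) *ᵥ Θ.col l) := by
      rw [mulVec_eq_sum_col Θ, Matrix.mulVec_sum]
      refine Finset.sum_congr rfl fun l _ => ?_
      rw [Matrix.mulVec_smul, he, smul_smul, mul_comm]
    rw [h1, key]
    congr 1
    exact Finset.sum_congr rfl fun l _ => by ring

theorem IsEigenAnalysis.col_mem_admissibleScores
    (hE : IsEigenAnalysis (augment X * regWeights X lam (indicatorMatrix y))
      (indicatorMatrix y) Θ a) (k : κ) :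
    Θ.col k ∈ admissibleScores (indicatorMatrix y) Θ a k := by
  obtain ⟨-, ho⟩ := (isEigenAnalysis_iff X lam y Θ a).1 hE
  refine ⟨?_, fun l hl => ?_⟩
  · rw [sum_indicatorMatrix_mulVec_sq, ho, if_pos rfl, inv_mul_cancel₀]
    simp
  · rw [indicatorMatrix_mulVec_dotProduct, ho, if_neg]
    rintro rfl
    exact lt_irrefl _ hl

/-- With β optimal the loss is N − N Σ a_l x_l², where x are the coordinates of θ and Σ x_l² = 1.
Admissibility kills every coordinate with a_l > a_k, so the weighted mean of eigenvalues is at most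
a_k. -/
theorem IsEigenAnalysis.osLoss_le
    (hE : IsEigenAnalysis (augment X * regWeights X lam (indicatorMatrix y))
      (indicatorMatrix y) Θ a) (hlam : 0 ≤ lam) (h : IsUnit (regScatter X lam).det) (k : κ)
    {θ : κ → ℝ} (hθ : θ ∈ admissibleScores (indicatorMatrix y) Θ a k) (β : p ⊕ Unit → ℝ) :
    osLoss X lam (indicatorMatrix y)
        (regWeights X lam (indicatorMatrix y) *ᵥ Θ.col k) (Θ.col k) ≤
      osLoss X lam (indicatorMatrix y) β θ := by
  obtain ⟨he, ho⟩ := (isEigenAnalysis_iff X lam y Θ a).1 hE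
  obtain ⟨h1, h2⟩ := hθ
  have hN : (0 : ℝ) < Fintype.card n := by simp [Fintype.card_pos]
  refine le_trans ?_ (osLoss_regWeights_le X hlam h (indicatorMatrix y) β θ)
  rw [osLoss_regWeights X h, osLoss_regWeights X h]
  change _ - Θ.col k ⬝ᵥ (fitCross X lam y *ᵥ Θ.col k) ≤ _ - θ ⬝ᵥ (fitCross X lam y *ᵥ θ)
  have h3 : ∑ i, (indicatorMatrix y *ᵥ θ) i ^ 2 = Fintype.card n := by
    field_simp at h1
    exact h1
  have h4 := hE.mulVec_expansion θ
  set x : κ → ℝ := fun l => (Fintype.card n : ℝ)⁻¹ *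
      (Θ.col l ⬝ᵥ (Matrix.diagonal (classWeight y) *ᵥ θ)) with hx
  have hx0 : ∀ l, a k < a l → x l = 0 := by
    intro l hl
    have := h2 l hl
    rw [indicatorMatrix_mulVec_dotProduct] at this
    simp only [hx, this, mul_zero]
  obtain ⟨h5, h6⟩ := hE.dotProduct_expansion x
  rw [← h4] at h5 h6
  have h7 : ∑ l, x l ^ 2 = 1 := by
    rw [sum_indicatorMatrix_mulVec_sq, h5] at h3
    exact mul_left_cancel₀ hN.ne' (h3.trans (mul_one _).symm)
  have h8 : ∑ l, a l * x l ^ 2 ≤ a k := by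
    calc ∑ l, a l * x l ^ 2 ≤ ∑ l, a k * x l ^ 2 := by
          refine Finset.sum_le_sum fun l _ => ?_
          rcases lt_or_ge (a k) (a l) with hl | hl
          · rw [hx0 l hl]; simp
          · exact mul_le_mul_of_nonneg_right hl (sq_nonneg _)
      _ = a k := by rw [← Finset.mul_sum, h7, mul_one]
  rw [h3, h6, sum_indicatorMatrix_mulVec_sq, he, dotProduct_smul, ho, if_pos rfl, smul_eq_mul]
  nlinarith [mul_le_mul_of_nonneg_left h8 hN.le]

theorem IsEigenAnalysis.col_ne_zero
    (hE : IsEigenAnalysis (augment X * regWeights X lam (indicatorMatrix y))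
      (indicatorMatrix y) Θ a) (k : κ) : Θ.col k ≠ 0 := by
  intro h0
  have := ((isEigenAnalysis_iff X lam y Θ a).1 hE).2 k k
  rw [h0, zero_dotProduct, if_pos rfl] at this
  exact Nat.cast_ne_zero.2 Fintype.card_ne_zero this.symm

theorem IsEigenAnalysis.existsUnique_eq_one [Nonempty κ]
    (hE : IsEigenAnalysis (augment X * regWeights X lam (indicatorMatrix y))
      (indicatorMatrix y) Θ a) (h : IsUnit (regScatter X lam).det)
    (hy : ∀ j, 0 < classWeight y j) (hS : (withinScatter X y + lam • 1).PosDef)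
    (hr : Fintype.card κ ≤ (betweenScatter X y).rank + 1) : ∃! j, a j = 1 := by
  obtain ⟨he, ho⟩ := (isEigenAnalysis_iff X lam y Θ a).1 hE
  have hN : (Fintype.card n : ℝ) ≠ 0 := by simp
  have hex : ∃ j, a j = 1 := by
    -- Otherwise every column is centred, so the constant vector has zero coordinates in the basis
    -- and would be zero.
    by_contra! hne
    have h1 := hE.mulVec_expansion fun _ => 1
    have h2 : ∀ l, Θ.col l ⬝ᵥ (Matrix.diagonal (classWeight y) *ᵥ fun _ => 1) = 0 := by
      intro l
      rw [dotProduct_diagonal_mulVec, ← hE.centred_of_ne_one h (hne l)]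
      simp
    simp only [h2, mul_zero] at h1
    obtain ⟨j⟩ := ‹Nonempty κ›
    have := congrFun h1 j
    simp [Matrix.mulVec, dotProduct] at this
  obtain ⟨j, hj⟩ := hex
  refine ⟨j, hj, fun l hl => ?_⟩
  by_contra hne
  set s : κ → ℝ := fun k => ∑ i, classWeight y i * Θ.col k i with hs
  have hcomb : ∀ u v : ℝ, fitCross X lam y *ᵥ (u • Θ.col l + v • Θ.col j) =
      (1 : ℝ) • (Matrix.diagonal (classWeight y) *ᵥ (u • Θ.col l + v • Θ.col j)) := by
    intro u v
    rw [Matrix.mulVec_add, Matrix.mulVec_smul, Matrix.mulVec_smul, he, he, hl, hj,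
      Matrix.mulVec_add, Matrix.mulVec_smul, Matrix.mulVec_smul, one_smul, one_smul, one_smul]
  have hcen : ∀ u v : ℝ, ∑ i, classWeight y i * (u • Θ.col l + v • Θ.col j) i =
      u * s l + v * s j := by
    intro u v
    rw [hs, Finset.mul_sum, Finset.mul_sum, ← Finset.sum_add_distrib]
    refine Finset.sum_congr rfl fun i _ => ?_
    simp only [Pi.add_apply, Pi.smul_apply, smul_eq_mul]
    ring
  have hzero : ∀ u v : ℝ, u * s l + v * s j = 0 → u • Θ.col l + v • Θ.col j = 0 := by
    intro u v huv
    by_contra h0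
    exact lt_irrefl _
      (eigenvalue_mem_Ioo X h hy hS hr h0 ((hcen u v).trans huv) (hcomb u v)).2
  have hcoef : ∀ u v : ℝ, u * s l + v * s j = 0 → u = 0 := by
    intro u v huv
    have h1 := congrArg (fun z => Θ.col l ⬝ᵥ (Matrix.diagonal (classWeight y) *ᵥ z)) (hzero u v huv)
    simp only [Matrix.mulVec_add, Matrix.mulVec_smul, dotProduct_add, dotProduct_smul, ho,
      if_neg hne, smul_eq_mul, if_true, mul_zero, add_zero, Matrix.mulVec_zero,
      dotProduct_zero] at h1
    exact (mul_eq_zero.1 h1).resolve_right hN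
  -- The combination s_j θ_l − s_l θ_j is centred with eigenvalue 1, hence zero, which gives s_j =
  -- 0. Then θ_j itself is centred and must vanish, a contradiction.
  have hsj := hcoef (s j) (-s l) (by ring)
  exact one_ne_zero (hcoef 1 0 (by
    have hsl : s l = 0 := by
      by_contra hsl
      have h1 := hzero 0 1 (by rw [hsj]; ring)
      rw [zero_smul, zero_add, one_smul] at h1
      exact hE.col_ne_zero j h1
    rw [hsl]; ring))

theorem IsEigenAnalysis.mem_Ioo
    (hE : IsEigenAnalysis (augment X * regWeights X lam (indicatorMatrix y))
      (indicatorMatrix y) Θ a) (h : IsUnit (regScatter X lam).det)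
    (hy : ∀ j, 0 < classWeight y j) (hS : (withinScatter X y + lam • 1).PosDef)
    (hr : Fintype.card κ ≤ (betweenScatter X y).rank + 1) {k : κ} (hk : a k ≠ 1) :
    0 < a k ∧ a k < 1 :=
  eigenvalue_mem_Ioo X h hy hS hr (hE.col_ne_zero k) (hE.centred_of_ne_one h hk)
    (((isEigenAnalysis_iff X lam y Θ a).1 hE).1 k)

end Scoring

/-! ### Discriminant coordinates from eigen-analyses, and back -/

section Coordinates

variable [Fintype n] [Nonempty n] [Fintype p] [DecidableEq p] {c : ℕ}

theorem IsEigenAnalysis.isDiscriminantCoordinates {X : Matrix n p ℝ} {lam : ℝ}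
    {y : n → Fin (c + 1)} {Θ : Matrix (Fin (c + 1)) (Fin (c + 1)) ℝ} {a : Fin (c + 1) → ℝ}
    (hE : IsEigenAnalysis (augment X * regWeights X lam (indicatorMatrix y))
      (indicatorMatrix y) Θ a) (h : IsUnit (regScatter X lam).det)
    (hy : ∀ j, 0 < classWeight y j) {j₀ : Fin (c + 1)}
    (ha : ∀ k, k ≠ j₀ → 0 < a k ∧ a k < 1) :
    IsDiscriminantCoordinates (betweenScatter X y) (withinScatter X y + lam • 1)
      (dropBias (regWeights X lam (indicatorMatrix y)) *
        scaledScores (Fintype.card n) Θ a j₀) := by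
  obtain ⟨he, ho⟩ := (isEigenAnalysis_iff X lam y Θ a).1 hE
  have hN : (0 : ℝ) < Fintype.card n := by simp [Fintype.card_pos]
  rw [isDiscriminantCoordinates_iff]
  have ha' := fun k : Fin c => ha _ (Fin.succAbove_ne j₀ k)
  have hc := fun k : Fin c => hE.centred_of_ne_one h (ha' k).2.ne
  refine ⟨fun k => a (j₀.succAbove k) / (1 - a (j₀.succAbove k)), fun k => ?_, fun k => ?_,
    fun k l => ?_⟩
  · exact (div_pos (ha' k).1 (sub_pos.2 (ha' k).2)).ne'
  · have h1 : (1 - a (j₀.succAbove k)) ≠ 0 := (sub_pos.2 (ha' k).2).ne'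
    have h2 := betweenScatter_mulVec_of_eigen X h hy (hc k) (he _)
    rw [mul_col, scaledScores_col _ _ _ _ ha, Matrix.mulVec_smul, Matrix.mulVec_smul,
      Matrix.mulVec_smul, smul_comm]
    congr 1
    beta_reduce
    rw [div_eq_inv_mul, mul_smul, ← h2, smul_smul, inv_mul_cancel₀ h1, one_smul]
  · rw [mul_col, mul_col, scaledScores_col _ _ _ _ ha, scaledScores_col _ _ _ _ ha,
      Matrix.mulVec_smul, Matrix.mulVec_smul, Matrix.mulVec_smul, smul_dotProduct,
      dotProduct_smul, dotProduct_withinScatter_of_eigen X h hy (hc k) (he _) (hc l) (he _), ho]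
    by_cases hkl : k = l
    · subst hkl
      have h1 : 0 < a (j₀.succAbove k) * (1 - a (j₀.succAbove k)) :=
        mul_pos (ha' k).1 (sub_pos.2 (ha' k).2)
      rw [if_pos rfl, if_pos rfl, smul_eq_mul, smul_eq_mul, ← mul_assoc, ← mul_inv,
        mul_mul_mul_comm, Real.mul_self_sqrt hN.le, Real.mul_self_sqrt h1.le,
        mul_comm (_ * _) (Fintype.card n : ℝ)]
      exact inv_mul_cancel₀ (mul_pos hN h1).ne'
    · rw [if_neg fun h0 => hkl (Fin.succAbove_right_injective h0), if_neg hkl]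
      simp

/-- Each discriminant direction determines its scores, and the constant vector supplies the one
missing column. -/
theorem exists_isEigenAnalysis_of_isDiscriminantCoordinates (X : Matrix n p ℝ) {lam : ℝ}
    (h : IsUnit (regScatter X lam).det) {y : n → Fin (c + 1)} (hy : ∀ j, 0 < classWeight y j)
    (W : Matrix p (Fin c) ℝ)
    (hW : IsDiscriminantCoordinates (betweenScatter X y) (withinScatter X y + lam • 1) W) :
    ∃ Θ a j₀, IsEigenAnalysis (augment X * regWeights X lam (indicatorMatrix y))
      (indicatorMatrix y) Θ a ∧ a j₀ = 1 ∧
        W = dropBias (regWeights X lam (indicatorMatrix y)) *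
          scaledScores (Fintype.card n) Θ a j₀ := by
  have hN : (0 : ℝ) < Fintype.card n := by simp [Fintype.card_pos]
  obtain ⟨Λ, hΛ0, hΛ, hWo⟩ := (isDiscriminantCoordinates_iff _ _ _).1 hW
  have hB : ∀ k l, (centredMeans X y *ᵥ W.col k) ⬝ᵥ
      (Matrix.diagonal (classWeight y) *ᵥ (centredMeans X y *ᵥ W.col l)) =
      if k = l then Λ l else 0 := by
    intro k l
    rw [← dotProduct_betweenScatter_mulVec, hΛ, dotProduct_smul, hWo, smul_eq_mul, mul_ite,
      mul_one, mul_zero]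
  -- Each Λ k equals wᵀ S_b w ≥ 0 for its column w, and it is non-zero by assumption.
  have hΛpos : ∀ k, 0 < Λ k := by
    intro k
    refine lt_of_le_of_ne ?_ (hΛ0 k).symm
    have := hB k k
    rw [if_pos rfl, dotProduct_diagonal_mulVec] at this
    rw [← this]
    exact Finset.sum_nonneg fun j _ => by
      rw [mul_assoc]; exact mul_nonneg (hy j).le (mul_self_nonneg _)
  -- The inverse of the correspondence Λ = α/(1 − α).
  set α : Fin c → ℝ := fun k => Λ k / (1 + Λ k) with hα
  have hα0 : ∀ k, 0 < α k := fun k => div_pos (hΛpos k) (by linarith [hΛpos k])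
  have hα1 : ∀ k, α k < 1 := fun k => by
    rw [hα, div_lt_one (by linarith [hΛpos k])]; linarith
  set s : Fin c → ℝ := fun k => Real.sqrt (Fintype.card n) * Real.sqrt (α k * (1 - α k)) with hs
  have hαα : ∀ k, 0 < α k * (1 - α k) := fun k => mul_pos (hα0 k) (sub_pos.2 (hα1 k))
  have hs0 : ∀ k, s k ≠ 0 := fun k =>
    (mul_pos (Real.sqrt_pos.2 hN) (Real.sqrt_pos.2 (hαα k))).ne'
  have hss : ∀ k, s k * s k = Fintype.card n * (α k * (1 - α k)) := fun k => by
    rw [hs, mul_mul_mul_comm, Real.mul_self_sqrt hN.le, Real.mul_self_sqrt (hαα k).le]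
  -- The scaling requires the unscaled weights of the scores to be `s k • W.col k`. The relation Cw
  -- = ατ then forces this choice.
  set τ : Fin c → Fin (c + 1) → ℝ := fun k => (s k / α k) • (centredMeans X y *ᵥ W.col k) with hτ
  have hτc : ∀ k, ∑ j, classWeight y j * τ k j = 0 := by
    intro k
    have := centredMeans_mulVec_centred X y (W.col k)
    rw [← mul_zero (s k / α k), ← this, Finset.mul_sum]
    refine Finset.sum_congr rfl fun j _ => ?_
    simp only [hτ, Pi.smul_apply, smul_eq_mul]
    ring
  have hwt : ∀ k, dropBias (regWeights X lam (indicatorMatrix y)) *ᵥ τ k = s k • W.col k := by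
    intro k
    refine dropBias_regWeights_mulVec_eq X h y (hτc k) _ ?_
    have h1 : (withinScatter X y + lam • 1) *ᵥ W.col k =
        (Λ k)⁻¹ • (betweenScatter X y *ᵥ W.col k) := by
      rw [hΛ, smul_smul, inv_mul_cancel₀ (hΛ0 k), one_smul]
    have h3 : (Λ k)⁻¹ • (betweenScatter X y *ᵥ W.col k) + betweenScatter X y *ᵥ W.col k =
        ((Λ k)⁻¹ + 1) • (betweenScatter X y *ᵥ W.col k) := by rw [add_smul, one_smul]
    have h2 : (Λ k)⁻¹ + 1 = (α k)⁻¹ := by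
      have := hΛ0 k
      rw [hα]; field_simp
    rw [Matrix.mulVec_smul, Matrix.add_mulVec, h1, h3, h2, hτ, Matrix.mulVec_smul,
      Matrix.mulVec_smul, ← betweenScatter_mulVec, smul_smul, div_eq_mul_inv]
  have hτe : ∀ k, fitCross X lam y *ᵥ τ k =
      α k • (Matrix.diagonal (classWeight y) *ᵥ τ k) := by
    intro k
    rw [fitCross_mulVec_centred X h y (hτc k), hwt, hτ, Matrix.mulVec_smul, Matrix.mulVec_smul,
      Matrix.mulVec_smul, smul_smul, mul_div_cancel₀ _ (hα0 k).ne']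
  have hτo : ∀ k l, τ k ⬝ᵥ (Matrix.diagonal (classWeight y) *ᵥ τ l) =
      if k = l then (Fintype.card n : ℝ) else 0 := by
    intro k l
    rw [hτ, Matrix.mulVec_smul, smul_dotProduct, dotProduct_smul, hB]
    by_cases hkl : k = l
    · subst hkl
      rw [if_pos rfl, if_pos rfl, smul_eq_mul, smul_eq_mul, ← mul_assoc, div_mul_div_comm, hss]
      have h1 : Λ k = α k / (1 - α k) := by
        have h3 : 1 + Λ k ≠ 0 := by linarith [hΛpos k]
        have h4 : 1 - α k = (1 + Λ k)⁻¹ := by rw [hα]; field_simp; ring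
        rw [h4, hα]; field_simp
      have h2 := (hα0 k).ne'
      have h3 := (sub_pos.2 (hα1 k)).ne'
      rw [h1]; field_simp
    · rw [if_neg hkl, if_neg hkl]; simp
  -- The constant vector goes in column 0 with eigenvalue 1. Its squared M-norm is the sum of the
  -- class sizes, that is N, so it needs no rescaling.
  set Θ : Matrix (Fin (c + 1)) (Fin (c + 1)) ℝ :=
    Matrix.of fun j k => (Fin.cons (fun _ => 1) τ : Fin (c + 1) → Fin (c + 1) → ℝ) k j with hΘ
  set a : Fin (c + 1) → ℝ := Fin.cons 1 α with ha
  have hc0 : Θ.col 0 = fun _ => 1 := rfl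
  have hcs : ∀ k : Fin c, Θ.col k.succ = τ k := fun k => rfl
  have h0τ : ∀ k, (fun _ => (1 : ℝ)) ⬝ᵥ (Matrix.diagonal (classWeight y) *ᵥ τ k) = 0 := by
    intro k
    rw [dotProduct_diagonal_mulVec, ← hτc k]
    simp
  have hE : IsEigenAnalysis (augment X * regWeights X lam (indicatorMatrix y))
      (indicatorMatrix y) Θ a := by
    rw [isEigenAnalysis_iff]
    constructor
    · intro k
      refine Fin.cases ?_ (fun k => ?_) k
      · rw [hc0, fitCross_mulVec_one X h]
        ext j
        simp [ha, Matrix.mulVec_diagonal]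
      · rw [hcs, hτe]; rfl
    · intro k l
      refine Fin.cases ?_ (fun k => ?_) k <;> refine Fin.cases ?_ (fun l => ?_) l
      · rw [hc0, dotProduct_diagonal_mulVec, if_pos rfl]
        simpa using sum_classWeight y
      · rw [hc0, hcs, h0τ, if_neg (Fin.succ_ne_zero l).symm]
      · rw [hc0, hcs, if_neg (Fin.succ_ne_zero k), dotProduct_diagonal_mulVec, ← hτc k]
        simp
      · rw [hcs, hcs, hτo]
        simp
  refine ⟨Θ, a, 0, hE, rfl, ?_⟩
  have haI : ∀ k, k ≠ 0 → 0 < a k ∧ a k < 1 := by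
    intro k
    refine Fin.cases (fun h0 => absurd rfl h0) (fun k _ => ?_) k
    exact ⟨hα0 k, hα1 k⟩
  have hcol : ∀ k, W.col k = (dropBias (regWeights X lam (indicatorMatrix y)) *
      scaledScores (Fintype.card n) Θ a 0).col k := by
    intro k
    rw [mul_col, scaledScores_col _ _ _ _ haI, Matrix.mulVec_smul, Fin.zero_succAbove, hcs, hwt,
      smul_smul]
    change W.col k = ((s k)⁻¹ * s k) • W.col k
    rw [inv_mul_cancel₀ (hs0 k), one_smul]
  ext q k
  exact congrFun (hcol k) q

end Coordinates

end MultiLDA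

/-! ### Assembly on the training set -/

theorem mainTheorem5 {N P c : ℕ} (X : Matrix (Fin N) (Fin P) ℝ) (lam : ℝ) (hlam : 0 ≤ lam)
    (labels : Fin N → Fin (c + 1)) (σ : Equiv.Perm (Fin N)) (Te : Finset (Fin N))
    (H : Matrix (Fin N) (Fin N) ℝ) (hH : H = hatMatrix X lam)
    (y : Fin N → Fin (c + 1)) (hy : y = labels ∘ σ)
    (Y : Matrix (Fin N) (Fin (c + 1)) ℝ) (hY : Y = indicatorMatrix y)
    (YTr : Matrix {i // i ∉ Te} (Fin (c + 1)) ℝ) (hYTr : YTr = trainRows Te Y)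
    (XTr : Matrix {i // i ∉ Te} (Fin P) ℝ) (hXTr : XTr = trainRows Te X)
    (XTe : Matrix {i // i ∈ Te} (Fin P) ℝ) (hXTe : XTe = testRows Te X)
    (yTr : {i // i ∉ Te} → Fin (c + 1)) (hyTr : yTr = fun i : {i // i ∉ Te} => y i)
    (NTr : ℕ) (hNTr : NTr = Fintype.card {i // i ∉ Te})
    (FTr : Matrix {i // i ∉ Te} (Fin (c + 1)) ℝ) (hFTr : FTr = cvFitTrain H Y Te)
    (FTe : Matrix {i // i ∈ Te} (Fin (c + 1)) ℝ) (hFTe : FTe = cvFitTest H Y Te)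
    -- the regression model retrained on the training set
    (Bt : Matrix (Fin P ⊕ Unit) (Fin (c + 1)) ℝ) (hBt : Bt = regWeights XTr lam YTr)
    -- scatter matrices of the training set
    (Sb : Matrix (Fin P) (Fin P) ℝ) (hSb : Sb = betweenScatter XTr yTr)
    (Sw : Matrix (Fin P) (Fin P) ℝ) (hSw : Sw = withinScatter XTr yTr + lam • (1 : Matrix (Fin P) (Fin P) ℝ))
    -- the training regression problem is non-degenerate (automatic if `0 < lam` and `NTr > 0`)
    (hTr : IsUnit (regScatter XTr lam).det) :
    -- Step 1: the inverses exist, and the updated fits are those of the retrained model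
    (IsUnit (regScatter X lam).det ∧ IsUnit (1 - hatTest Te H).det ∧
      (∀ B, (∀ B', regLoss XTr lam YTr B ≤ regLoss XTr lam YTr B') ↔ B = Bt) ∧
      FTr = augment XTr * Bt ∧ FTe = augment XTe * Bt) ∧
    -- Step 2: optimal scoring yields the discriminant coordinates and scores of the retrained LDA
    ((∀ j, ∃ i, yTr i = j) → Sw.PosDef → Sb.rank = c →
      (∃ Θ a, IsEigenAnalysis FTr YTr Θ a) ∧
      (∀ Θ a, IsEigenAnalysis FTr YTr Θ a →
        (∃! j, a j = 1) ∧
        (∀ k, Θ.col k ∈ admissibleScores YTr Θ a k ∧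
          ∀ θ ∈ admissibleScores YTr Θ a k, ∀ β,
            osLoss XTr lam YTr (Bt *ᵥ Θ.col k) (Θ.col k) ≤ osLoss XTr lam YTr β θ) ∧
        ∀ j₀, a j₀ = 1 →
          (∀ k, k ≠ j₀ → 0 < a k ∧ a k < 1) ∧
          ∃ W : Matrix (Fin P) (Fin c) ℝ,
            W = dropBias Bt * scaledScores NTr Θ a j₀ ∧
            IsDiscriminantCoordinates Sb Sw W ∧
            (∃ b : Fin c → ℝ,
              (∀ i, (FTe * scaledScores NTr Θ a j₀) i = (XTe * W) i + b) ∧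
              ∀ i, (FTr * scaledScores NTr Θ a j₀) i = (XTr * W) i + b) ∧
            ∀ i j,
              ‖WithLp.toLp 2 ((FTe * scaledScores NTr Θ a j₀) i -
                  classMean (FTr * scaledScores NTr Θ a j₀) yTr j)‖ =
                ‖WithLp.toLp 2 ((XTe * W) i - classMean (XTr * W) yTr j)‖) ∧
      (∀ W : Matrix (Fin P) (Fin c) ℝ, IsDiscriminantCoordinates Sb Sw W →
        ∃ Θ a j₀, IsEigenAnalysis FTr YTr Θ a ∧ a j₀ = 1 ∧
          W = dropBias Bt * scaledScores NTr Θ a j₀)) := by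
  have hYTr' : YTr = indicatorMatrix yTr := by subst hYTr hY hyTr; rfl
  have hFTr' : FTr = augment XTr * Bt := by
    subst hFTr hH hBt hXTr hYTr
    exact cvFitTrain_hatMatrix Te X hlam hTr Y
  have hFTe' : FTe = augment XTe * Bt := by
    subst hFTe hH hBt hXTr hYTr hXTe
    exact cvFitTest_hatMatrix Te X hlam hTr Y
  refine ⟨⟨?_, ?_, ?_, hFTr', hFTe'⟩, ?_⟩
  · subst hXTr
    exact isUnit_det_regScatter Te X hlam hTr
  · subst hXTr hH
    exact isUnit_det_one_sub_hatTest Te X hlam hTr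
  · subst hBt
    exact regLoss_minimiser_iff XTr hlam hTr YTr
  intro hsurj hS hrank
  have hy0 : ∀ j, 0 < classWeight yTr j := classWeight_pos hsurj
  -- There are c + 1 ≥ 1 classes, so class 0 already supplies a training sample.
  have hne : Nonempty {i // i ∉ Te} := (hsurj 0).nonempty
  have hr : Fintype.card (Fin (c + 1)) ≤ (betweenScatter XTr yTr).rank + 1 := by
    rw [Fintype.card_fin, ← hSb, hrank]
  clear hFTr hFTe hYTr hXTr hXTe hyTr
  subst hFTr' hFTe' hBt hYTr' hSb hSw hNTr
  refine ⟨exists_isEigenAnalysis XTr lam hy0, fun Θ a hE => ⟨?_, fun k => ⟨?_, ?_⟩, ?_⟩, ?_⟩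
  · exact hE.existsUnique_eq_one hTr hy0 hS hr
  · exact hE.col_mem_admissibleScores k
  · exact fun θ hθ β => hE.osLoss_le hlam hTr k hθ β
  · intro j₀ hj₀
    have hu := hE.existsUnique_eq_one hTr hy0 hS hr
    have ha : ∀ k, k ≠ j₀ → 0 < a k ∧ a k < 1 := fun k hk =>
      hE.mem_Ioo hTr hy0 hS hr fun h1 => hk (hu.unique h1 hj₀)
    set S := scaledScores (Fintype.card {i // i ∉ Te}) Θ a j₀ with hSdef
    set B := regWeights XTr lam (indicatorMatrix yTr) with hB
    have hTe := augment_mul_mul_row XTe B S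
    have hTr' := augment_mul_mul_row XTr B S
    refine ⟨ha, dropBias B * S, rfl, hE.isDiscriminantCoordinates hTr hy0 ha,
      ⟨(B * S) (Sum.inr ()), hTe, hTr'⟩, fun i j => ?_⟩
    -- Score and centroid carry the same bias shift, the last row of `B * S`, which cancels in their
    -- difference.
    rw [hTe, classMean_add_const _ _ _ hTr' (hy0 j), add_sub_add_right_eq_sub]
  · exact fun W hW => exists_isEigenAnalysis_of_isDiscriminantCoordinates XTr hTr hy0 W hW
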